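/- Let $(R,\mathfrak m)$ be a Noetherian local ring of dimension $d\ge 2$ with $\operatorname{depth} R\ge d-1$; let $\lambda$ denote length. An element $a\in\mathfrak m$ is called superficial for a filtration $\{M_n\}_{n\ge 0}$ of an $R$-module $M$ (with respect to $\mathfrak m$) if there is $c\ge 0$ such that $(M_{n+1}:_M a)\cap M_c=M_n$ for all $n\ge c$. Let $x_1,\dots,x_d\in\mathfrak m$ be a maximal superficial sequence for the $\mathfrak m$-adic filtration, i.e. for $i=1,\dots,d$ the element $x_i$ is superficial for the filtration $\{(\mathfrak m^n+(x_1,\dots,x_{i-1}))/(x_1,\dots,x_{i-1})\}_n$ of $R/(x_1,\dots,x_{i-1})$, and put $J=(x_1,\dots,x_d)$. Then there is a (unique) polynomial $h\in\mathbb Z[t]$ with $$\sum_{n\ge 0}\lambda(\mathfrak m^n/\mathfrak m^{n+1})\,t^n=\frac{h(t)}{(1-t)^d};$$ put $e_2(\mathfrak m)=h''(1)/2!$, the second Hilbert coefficient. The lengths $\lambda(\mathfrak m^{n+1}/J\mathfrak m^n)$ are all finite, only finitely many of them are nonzero, and $$e_2(\mathfrak m)\le\sum_{n\ge 1} n\,\lambda(\mathfrak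 m^{n+1}/J\mathfrak m^n).$$ Moreover, equality holds if and only if $R$ is Cohen--Macaulay and $\operatorname{depth}\operatorname{gr}_{\mathfrak m}(R)\ge d-1$, where $\operatorname{gr}_{\mathfrak m}(R)=\bigoplus_{n\ge 0}\mathfrak m^n/\mathfrak m^{n+1}$ and its depth is taken in its maximal homogeneous ideal. -/

import Mathlib

open Polynomial

universe u v

noncomputable section

/-! ### Filtrations, superficial sequences, Hilbert coefficients -/

/-- The length `λ(A / B)` of the quotient of a submodule `A` by a submodule `B ⊆ A`. -/
def quotLength {R : Type u} [CommRing R] {M : Type v} [AddCommGroup M] [Module R M]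
    (A B : Submodule R M) : ℕ∞ :=
  Module.length R (A ⧸ B.submoduleOf A)

/-- The filtration `{(M_n + N) / N}` induced on `M / N` by a filtration `{M_n}` of `M`. -/
def quotFiltration {R : Type u} [CommRing R] {M : Type v} [AddCommGroup M] [Module R M]
    (F : ℕ → Submodule R M) (N : Submodule R M) : ℕ → Submodule R (M ⧸ N) :=
  fun n => (F n).map N.mkQ

/-- `a ∈ q` is superficial for `q` with respect to the filtration `{M_n}` of `M`: for some `c`,
`(M_{n+1} :_M a) ∩ M_c = M_n` for all `n ≥ c`. -/
def IsSuperficialElement {R : Type u} [CommRing R] {M : Type v} [AddCommGroup M] [Module R M]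
    (q : Ideal R) (F : ℕ → Submodule R M) (a : R) : Prop :=
  a ∈ q ∧ ∃ c : ℕ, ∀ n : ℕ, c ≤ n →
    (F (n + 1)).comap (LinearMap.lsmul R M a) ⊓ F c = F n

/-- `a_0, …, a_{r-1}` is a superficial sequence: each `a_i` is superficial with respect to the
filtration induced on `M / (a_0, …, a_{i-1}) M`. -/
def IsSuperficialSequence {R : Type u} [CommRing R] {M : Type v} [AddCommGroup M] [Module R M]
    (q : Ideal R) (F : ℕ → Submodule R M) {r : ℕ} (a : Fin r → R) : Prop :=
  ∀ i : Fin r, IsSuperficialElement q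
    (quotFiltration F (Ideal.span (a '' Set.Iio i) • (⊤ : Submodule R M))) (a i)

/-- The `I`-adic filtration `{I ^ n}` of the ring `R`. -/
def adicFiltration {R : Type u} [CommRing R] (I : Ideal R) : ℕ → Submodule R R :=
  fun n => I ^ n

/-- The Hilbert series `∑ λ(M_n / M_{n+1}) t ^ n` of a filtration (all these lengths are finite
for a good filtration with respect to an `𝔪`-primary ideal). -/
def hilbertSeries {R : Type u} [CommRing R] {M : Type v} [AddCommGroup M] [Module R M]
    (F : ℕ → Submodule R M) : PowerSeries ℤ :=
  PowerSeries.mk fun n => ((quotLength (F n) (F (n + 1))).toNat : ℤ)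

/-- `h ∈ ℤ[t]` is the numerator of the Hilbert series over `(1 - t) ^ d`; there is at most one. -/
def IsHPolynomial {R : Type u} [CommRing R] {M : Type v} [AddCommGroup M] [Module R M]
    (F : ℕ → Submodule R M) (d : ℕ) (h : ℤ[X]) : Prop :=
  (h : PowerSeries ℤ) = hilbertSeries F * (1 - PowerSeries.X) ^ d

open Classical in
/-- The `h`-polynomial of a filtration of a `d`-dimensional module (`0` if there is none). -/
def hPolynomial {R : Type u} [CommRing R] {M : Type v} [AddCommGroup M] [Module R M]
    (F : ℕ → Submodule R M) (d : ℕ) : ℤ[X] :=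
  if H : ∃ h : ℤ[X], IsHPolynomial F d h then H.choose else 0

/-- The Hilbert coefficient `e_i = h^{(i)}(1) / i!` of a filtration of a `d`-dimensional module.
The `i`-th Hasse derivative is the `i`-th derivative divided by `i!`. -/
def hilbertCoeff {R : Type u} [CommRing R] {M : Type v} [AddCommGroup M] [Module R M]
    (F : ℕ → Submodule R M) (d i : ℕ) : ℤ :=
  (Polynomial.hasseDeriv i (hPolynomial F d)).eval 1

/-! ### Depth and the Cohen–Macaulay property -/

/-- The depth of `M` in the ideal `I`: the supremum of the lengths of the `M`-regular sequences
contained in `I`. -/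
def idealDepth {R : Type u} [CommRing R] (I : Ideal R) (M : Type v) [AddCommGroup M]
    [Module R M] : ℕ∞ :=
  ⨆ (rs : List R) (_ : RingTheory.Sequence.IsRegular M rs ∧ ∀ r ∈ rs, r ∈ I), (rs.length : ℕ∞)

/-- The depth of a local ring. -/
def localDepth (R : Type u) [CommRing R] [IsLocalRing R] : ℕ∞ :=
  idealDepth (IsLocalRing.maximalIdeal R) R

/-- A (Noetherian) local ring is Cohen–Macaulay if its depth equals its dimension. -/
def IsCohenMacaulayLocal (R : Type u) [CommRing R] [IsLocalRing R] : Prop :=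
  (localDepth R : WithBot ℕ∞) = ringKrullDim R

/-! ### The associated graded ring -/

/-- The ideal `⨁ I ^ (n + 1) t ^ n` of the Rees algebra `⨁ I ^ n t ^ n`. -/
def reesShift {R : Type u} [CommRing R] (I : Ideal R) : Ideal (reesAlgebra I) where
  carrier := {f | ∀ n, (f : R[X]).coeff n ∈ I ^ (n + 1)}
  zero_mem' n := by simp
  add_mem' {f g} hf hg n := by
    simpa using Ideal.add_mem _ (hf n) (hg n)
  smul_mem' f g hg n := by
    have : (f • g : reesAlgebra I).1 = (f : R[X]) * (g : R[X]) := rfl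
    rw [this, Polynomial.coeff_mul]
    refine Ideal.sum_mem _ ?_
    rintro ⟨i, j⟩ hij
    have hn : i + j = n := by simpa using hij
    rw [← hn, add_assoc, pow_add]
    exact Ideal.mul_mem_mul (f.2 i) (hg j)

/-- The associated graded ring `gr_I(R) = ⨁ I ^ n / I ^ (n + 1)`. -/
abbrev AssociatedGradedRing {R : Type u} [CommRing R] (I : Ideal R) : Type u :=
  reesAlgebra I ⧸ reesShift I

/-- The ideal of `gr_I(R)` generated by the elements of positive degree, that is, the classes of
the `f ∈ ⨁ I ^ n t ^ n` whose constant term lies in `I`. If `I` is a maximal ideal, this is the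
maximal homogeneous ideal. -/
def grIrrelevant {R : Type u} [CommRing R] (I : Ideal R) : Ideal (AssociatedGradedRing I) :=
  (I.comap ((Polynomial.constantCoeff : R[X] →+* R).comp
    (reesAlgebra I).val.toRingHom)).map (Ideal.Quotient.mk (reesShift I))

/-- The depth of `gr_𝔪(R)` (in its maximal homogeneous ideal), for a local ring `(R, 𝔪)`. -/
def grDepth (R : Type u) [CommRing R] [IsLocalRing R] : ℕ∞ :=
  idealDepth (R := AssociatedGradedRing (IsLocalRing.maximalIdeal R))
    (grIrrelevant (IsLocalRing.maximalIdeal R))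
    (AssociatedGradedRing (IsLocalRing.maximalIdeal R))

end

/-! Write `K` for the ideal of the first `d - 1` elements and `x` for the last one. Since depth is
at least `d - 1`, the first `d - 1` elements form a regular sequence (`regularMod_of_le_ringDepth`),
and `R / K` has dimension one.

Multiplication by `x` on `R / K` gives `H(n) = e - (v'_n - W_n)`, where `v'_n` is the analogue of
`v_n = λ(𝔪^(n+1) / J𝔪^n)` for `R / K`, and `W_n` is the length of `((K : x) ∩ (𝔪^n + K)) / K`
(`SuperficialMod.exists_hilbertFun_eq`). So the numerator of the Hilbert series of `R / K` is `e -
(1 - t) ∑ (v'_n - W_n) t^n`, and its second coefficient is `∑ n (v'_n - W_n)`. Lifting back along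
the regular elements changes the numerator by multiples of `(1 - t)^k` with `k ≥ 2`. Only `k = 2`,
in the passage from dimension one to two, affects `e_2`: it subtracts `∑ B_n`, a sum of lengths of
colon quotients (`exists_isHPolynomial`).

With `v_n = D_n + v'_n`, where `D_n` is the length lost modulo `K`, this gives `∑ n v_n - e_2 = ∑ n
(D_n + W_n) + ∑ B_n ≥ 0`.

If equality holds, `W_1 = 0` makes `x` regular modulo `K`, so `R` is Cohen–Macaulay, and `D_n = 0`
for `n ≥ 1` gives `K ∩ 𝔪^(n+1) ⊆ J𝔪^n`. This descends to every initial segment and makes the initial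
forms a regular sequence, as in the Valabrega–Valla criterion
(`le_ringDepth_grIrrelevant_of_inf_pow_le`). Conversely, superficial sequences are strict up to the
depth of the graded ring (`inf_pow_le_of_le_ringDepth_grIrrelevant`), and all three defects vanish.
-/

noncomputable section

/-! ### Depth and extension of regular sequences, through vanishing of Ext. -/

open RingTheory.Sequence CategoryTheory Abelian in
theorem subsingleton_ext_quotSMulTop {R : Type u} [CommRing R] {N M : ModuleCat.{u} R} {r : R}
    (hr : IsSMulRegular M r) {n : ℕ} (h : ∀ i < n + 1, Subsingleton (Ext N M i)) :
    ∀ i < n, Subsingleton (Ext N (ModuleCat.of R (QuotSMulTop r M)) i) := by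
  intro i hi
  have zero1 := AddCommGrpCat.isZero_of_iff_subsingleton.mpr (h i (by omega))
  have zero2 := AddCommGrpCat.isZero_of_iff_subsingleton.mpr (h (i + 1) (by omega))
  exact AddCommGrpCat.subsingleton_of_isZero <| ShortComplex.Exact.isZero_of_both_zeros
    ((Ext.covariant_sequence_exact₃' N hr.smulShortComplex_shortExact) i (i + 1) rfl)
    (zero1.eq_zero_of_src _) (zero2.eq_zero_of_tgt _)

-- Dimension shifting: each regular element costs one degree of Ext vanishing, so fewer than `k` of
-- them leave at least degree `0`, which is Hom.
open RingTheory.Sequence CategoryTheory Abelian in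
theorem subsingleton_linearMap_quotient_ofList {R : Type u} [CommRing R] (N : ModuleCat.{u} R)
    (rs : List R) (M : ModuleCat.{u} R) (hrs : IsWeaklyRegular M rs) {k : ℕ}
    (hk : rs.length < k) (h : ∀ i < k, Subsingleton (Ext N M i)) :
    Subsingleton (N →ₗ[R] M ⧸ (Ideal.ofList rs • ⊤ : Submodule R M)) := by
  induction rs generalizing M k with
  | nil =>
    have : Subsingleton (N →ₗ[R] M) :=
      have := h 0 hk
      (Ext.addEquiv₀.trans ModuleCat.homAddEquiv).symm.subsingleton
    let e := Submodule.quotEquivOfEqBot (Ideal.ofList ([] : List R) • ⊤ : Submodule R M)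
      (by rw [Ideal.ofList_nil (R := R), Submodule.bot_smul])
    exact (LinearEquiv.congrRight (M := N) e).toEquiv.subsingleton
  | cons r rs ih =>
    rw [isWeaklyRegular_cons_iff] at hrs
    obtain ⟨k, rfl⟩ : ∃ l, k = l + 1 := ⟨k - 1, by simp at hk; omega⟩
    have := ih (ModuleCat.of R (QuotSMulTop r M)) hrs.2 (k := k) (by simpa using hk)
      (subsingleton_ext_quotSMulTop hrs.1 h)
    let e := Submodule.quotOfListConsSMulTopEquivQuotSMulTopInner M r rs
    exact (LinearEquiv.congrRight (M := N) e).toEquiv.subsingleton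

open RingTheory.Sequence in
theorem exists_isRegular_of_le_idealDepth {R : Type u} [CommRing R] {I : Ideal R} {M : Type v}
    [AddCommGroup M] [Module R M] {k : ℕ} (hk : 0 < k) (h : (k : ℕ∞) ≤ idealDepth I M) :
    ∃ rs : List R, IsRegular M rs ∧ (∀ r ∈ rs, r ∈ I) ∧ k ≤ rs.length := by
  by_contra! H
  have : idealDepth I M ≤ ((k - 1 : ℕ) : ℕ∞) := by
    refine iSup₂_le fun rs hrs => ?_
    have := H rs hrs.1 hrs.2
    exact_mod_cast (by omega : rs.length ≤ k - 1)
  have := h.trans this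
  norm_cast at this
  omega

/-- If the depth of `M` in `I` exceeds the length of an `M`-regular sequence `rs` in `I`, then `I`
contains an `M / rs M`-regular element. -/
theorem exists_isSMulRegular_quotient_of_lt_idealDepth {R : Type u} [CommRing R]
    [IsNoetherianRing R] {I : Ideal R} {M : Type u} [AddCommGroup M] [Module R M]
    [Module.Finite R M] (hI : I • (⊤ : Submodule R M) < ⊤) {k : ℕ}
    (h : (k : ℕ∞) ≤ idealDepth I M) {rs : List R}
    (hrs : RingTheory.Sequence.IsWeaklyRegular M rs) (hk : rs.length < k) :
    ∃ z ∈ I, IsSMulRegular (M ⧸ (Ideal.ofList rs • ⊤ : Submodule R M)) z := by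
  obtain ⟨ss, h1, h2, h3⟩ := exists_isRegular_of_le_idealDepth (by omega) h
  -- Vanishing of `Ext (R ⧸ I) M` does not depend on a sequence: the long sequence `ss` provides it,
  -- and the given sequence `rs` then consumes it.
  have hs := ModuleCat.subsingleton_ext_of_exists_isRegular I (ModuleCat.of R (R ⧸ I))
    (by rw [Module.support_eq_zeroLocus]; simp [Ideal.annihilator_quotient]) (ModuleCat.of R M)
    hI ss h2 h1
  have := subsingleton_linearMap_quotient_ofList (ModuleCat.of R (R ⧸ I)) rs (ModuleCat.of R M)
    hrs hk (fun i hi => hs i (by omega))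
  obtain ⟨z, hz, hz'⟩ := (IsSMulRegular.subsingleton_linearMap_iff
    (N := R ⧸ I)).mp this
  exact ⟨z, by simpa [Ideal.annihilator_quotient] using hz, hz'⟩

/-! ### Regular and superficial elements modulo an ideal -/

/-- The ideal `(y_0, …, y_{i-1})`. -/
def initialIdeal {A : Type u} [CommRing A] (y : ℕ → A) (i : ℕ) : Ideal A :=
  Ideal.ofList ((List.range i).map y)

/-- The depth of a ring in one of its ideals. -/
def ringDepth {A : Type u} [CommRing A] (I : Ideal A) : ℕ∞ :=
  idealDepth I A

/-- `x` is a nonzerodivisor modulo `K`. -/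
def RegularMod {A : Type u} [CommRing A] (K : Ideal A) (x : A) : Prop :=
  ∀ a, x * a ∈ K → a ∈ K

/-- `x` is superficial for the filtration `{𝔪 ^ n + K}`. -/
def SuperficialMod {A : Type u} [CommRing A] (m K : Ideal A) (x : A) : Prop :=
  x ∈ m ∧ ∃ c : ℕ, ∀ n, c ≤ n → ∀ a ∈ m ^ c ⊔ K, x * a ∈ m ^ (n + 1) ⊔ K → a ∈ m ^ n ⊔ K

section

variable {A : Type u} [CommRing A]

@[simp] theorem initialIdeal_zero (y : ℕ → A) : initialIdeal y 0 = ⊥ := by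
  simp [initialIdeal]

theorem initialIdeal_succ (y : ℕ → A) (i : ℕ) :
    initialIdeal y (i + 1) = initialIdeal y i ⊔ Ideal.span {y i} := by
  simp [initialIdeal, List.range_succ]

theorem initialIdeal_eq_span (y : ℕ → A) (i : ℕ) :
    initialIdeal y i = Ideal.span (y '' {j | j < i}) := by
  rw [initialIdeal, Ideal.ofList]
  congr 1
  ext a
  simp

theorem mem_initialIdeal (y : ℕ → A) {i j : ℕ} (h : j < i) : y j ∈ initialIdeal y i := by
  rw [initialIdeal_eq_span]
  exact Ideal.subset_span ⟨j, h, rfl⟩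

theorem initialIdeal_mono (y : ℕ → A) : Monotone (initialIdeal y) :=
  monotone_nat_of_le_succ fun i => by rw [initialIdeal_succ]; exact le_sup_left

theorem initialIdeal_le {y : ℕ → A} {i : ℕ} {I : Ideal A} (h : ∀ j < i, y j ∈ I) :
    initialIdeal y i ≤ I := by
  rw [initialIdeal_eq_span, Ideal.span_le]
  rintro _ ⟨j, hj, rfl⟩
  exact h j hj

theorem isSMulRegular_quotient_iff (K : Ideal A) (x : A) :
    IsSMulRegular (A ⧸ (K • ⊤ : Submodule A A)) x ↔ RegularMod K x := by
  rw [isSMulRegular_on_quot_iff_lsmul_comap_le]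
  simp [SetLike.le_def, RegularMod]

theorem isWeaklyRegular_map_range_iff (y : ℕ → A) (i : ℕ) :
    RingTheory.Sequence.IsWeaklyRegular A ((List.range i).map y) ↔
      ∀ j < i, RegularMod (initialIdeal y j) (y j) := by
  rw [RingTheory.Sequence.isWeaklyRegular_iff]
  simp only [List.length_map, List.length_range, List.getElem_map, List.getElem_range]
  refine forall₂_congr fun j hj => ?_
  rw [← List.map_take, List.take_range, min_eq_left hj.le]
  exact isSMulRegular_quotient_iff _ _

theorem RegularMod.pow {K : Ideal A} {x : A} (h : RegularMod K x) (n : ℕ) :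
    RegularMod K (x ^ n) := by
  induction n with
  | zero => intro a; simp
  | succ n ih => intro a ha; exact h a (ih _ (by rwa [← mul_assoc, ← pow_succ]))

/-- A regular sequence in `I` shorter than the depth can be extended inside `I`. -/
theorem exists_regularMod_of_lt_idealDepth [IsNoetherianRing A] {I : Ideal A} (hI : I ≠ ⊤)
    {k i : ℕ} (h : (k : ℕ∞) ≤ ringDepth I) (y : ℕ → A) (hik : i < k)
    (hy : ∀ j < i, RegularMod (initialIdeal y j) (y j)) :
    ∃ z ∈ I, RegularMod (initialIdeal y i) z := by
  obtain ⟨z, hz, hz'⟩ := exists_isSMulRegular_quotient_of_lt_idealDepth (I := I) (M := A)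
    (by simpa [lt_top_iff_ne_top] using hI) h ((isWeaklyRegular_map_range_iff y i).2 hy)
    (by simpa using hik)
  exact ⟨z, hz, (isSMulRegular_quotient_iff _ _).1 hz'⟩

/-- A regular sequence in a proper ideal bounds its depth from below. -/
theorem le_idealDepth_of_regularMod {I : Ideal A} (hI : I ≠ ⊤) (y : ℕ → A) (i : ℕ)
    (hyI : ∀ j < i, y j ∈ I) (hy : ∀ j < i, RegularMod (initialIdeal y j) (y j)) :
    (i : ℕ∞) ≤ ringDepth I := by
  have : (((List.range i).map y).length : ℕ∞) ≤ ringDepth I := by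
    refine le_iSup₂_of_le (f := fun (rs : List A)
      (_ : RingTheory.Sequence.IsRegular A rs ∧ ∀ r ∈ rs, r ∈ I) => (rs.length : ℕ∞))
      ((List.range i).map y) ⟨⟨(isWeaklyRegular_map_range_iff y i).2 hy, ?_⟩, by simpa⟩ le_rfl
    intro h
    refine hI (top_le_iff.1 ?_)
    rw [h]
    rw [smul_eq_mul, Ideal.mul_top]
    exact initialIdeal_le hyI
  simpa using this

end

/-! ### Superficial elements in a Noetherian local ring. -/

section Local

variable {R : Type u} [CommRing R] [IsLocalRing R] [IsNoetherianRing R]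

local notation "𝔪" => IsLocalRing.maximalIdeal R

theorem mem_of_forall_mem_pow_sup (K : Ideal R) {a : R} (h : ∀ n, a ∈ 𝔪 ^ n ⊔ K) : a ∈ K := by
  have h1 := Ideal.iInf_pow_smul_eq_bot_of_isLocalRing (M := R ⧸ K) 𝔪
    (IsLocalRing.maximalIdeal.isMaximal R).ne_top
  rw [← Ideal.Quotient.eq_zero_iff_mem, ← Submodule.mem_bot (R := R), ← h1, Submodule.mem_iInf]
  intro n
  obtain ⟨b, hb, k, hk, rfl⟩ := Submodule.mem_sup.1 (h n)
  rw [map_add, Ideal.Quotient.eq_zero_iff_mem.2 hk, add_zero]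
  have : Ideal.Quotient.mk K b = b • (1 : R ⧸ K) := by
    rw [Algebra.smul_def, mul_one]; rfl
  rw [this]
  exact Submodule.smul_mem_smul hb trivial

/-- Superficiality puts such an `a` in every `𝔪 ^ n ⊔ K`, and Krull's intersection theorem in `R ⧸
K` finishes. -/
theorem SuperficialMod.exists_mem_pow {K : Ideal R} {x : R} (h : SuperficialMod 𝔪 K x) :
    ∃ c : ℕ, ∀ a ∈ 𝔪 ^ c ⊔ K, x * a ∈ K → a ∈ K := by
  obtain ⟨-, c, hc⟩ := h
  refine ⟨c, fun a ha hxa => mem_of_forall_mem_pow_sup K fun n => ?_⟩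
  have := hc (max n c) (le_max_right _ _) a ha (le_sup_right (a := 𝔪 ^ _) hxa)
  exact sup_le_sup_right (Ideal.pow_le_pow_right (le_max_left _ _)) K this

/-- A superficial element is regular modulo `K` as soon as `𝔪` contains some element which is. -/
theorem SuperficialMod.regularMod {K : Ideal R} {x z : R} (h : SuperficialMod 𝔪 K x)
    (hz : z ∈ 𝔪) (hzK : RegularMod K z) : RegularMod K x := by
  obtain ⟨c, hc⟩ := h.exists_mem_pow
  intro a ha
  -- The factor `z ^ c` moves `a` into `𝔪 ^ c`, where `x` is already cancellable modulo `K`, and is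
  -- then cancelled itself.
  refine hzK.pow c a (hc _ (Ideal.mem_sup_left (Ideal.mul_mem_right _ _
    (Ideal.pow_mem_pow hz c))) ?_)
  rw [mul_left_comm]
  exact K.mul_mem_left _ ha

theorem regularMod_of_le_ringDepth {k : ℕ} (h : (k : ℕ∞) ≤ ringDepth 𝔪) (y : ℕ → R)
    (hy : ∀ j < k, SuperficialMod 𝔪 (initialIdeal y j) (y j)) :
    ∀ j < k, RegularMod (initialIdeal y j) (y j) := by
  intro j
  induction j using Nat.strong_induction_on with
  | _ j ih =>
    intro hj
    obtain ⟨z, hz, hz'⟩ := exists_regularMod_of_lt_idealDepth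
      (IsLocalRing.maximalIdeal.isMaximal R).ne_top h y hj (fun l hl => ih l hl (hl.trans hj))
    exact (hy j hj).regularMod hz hz'

/-- Artin–Rees for `K ⊔ (x)` removes the restriction to `𝔪 ^ c ⊔ K` in superficiality. As `x` may be
a zerodivisor modulo `K`, `b` is only controlled up to `K : x`. -/
theorem SuperficialMod.exists_of_mul_mem {K : Ideal R} {x : R} (h : SuperficialMod 𝔪 K x) :
    ∃ N : ℕ, ∀ n, N ≤ n → ∀ b, x * b ∈ 𝔪 ^ (n + 1) ⊔ K →
      ∃ b' ∈ 𝔪 ^ n, x * (b - b') ∈ K := by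
  obtain ⟨-, c, hc⟩ := h
  obtain ⟨k, hk⟩ := Ideal.exists_pow_inf_eq_pow_smul (M := R) 𝔪 (K ⊔ Ideal.span {x})
  refine ⟨k + c, fun n hn b hb => ?_⟩
  obtain ⟨u, hu, w, hw, huw⟩ := Submodule.mem_sup.1 hb
  have hu' : u ∈ 𝔪 ^ (n + 1 - k) * (K ⊔ Ideal.span {x}) := by
    have h1 : u ∈ (𝔪 ^ (n + 1) • (⊤ : Ideal R) ⊓ (K ⊔ Ideal.span {x}) : Ideal R) := by
      refine ⟨by simpa using hu, ?_⟩
      have : u = x * b - w := by rw [← huw]; ring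
      rw [this]
      exact Ideal.sub_mem _ (Ideal.mem_sup_right (Ideal.mul_mem_right _ _
        (Ideal.mem_span_singleton_self x))) (Ideal.mem_sup_left hw)
    rw [hk (n + 1) (by omega), smul_eq_mul] at h1
    exact Ideal.mul_mono_right inf_le_right h1
  rw [Ideal.mul_sup] at hu'
  obtain ⟨s, hs, t, ht, rfl⟩ := Submodule.mem_sup.1 hu'
  obtain ⟨b', hb', rfl⟩ := Ideal.mem_mul_span_singleton.1 ht
  have hsK : s ∈ K := Ideal.mul_le_right hs
  have h2 : b' ∈ 𝔪 ^ n ⊔ K := by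
    refine hc n (by omega) b' (Ideal.mem_sup_left (Ideal.pow_le_pow_right (by omega) hb')) ?_
    have : x * b' = (s + b' * x) - s := by ring
    rw [this]
    exact Ideal.sub_mem _ (Ideal.mem_sup_left hu) (Ideal.mem_sup_right hsK)
  obtain ⟨b₁, hb₁, k₁, hk₁, rfl⟩ := Submodule.mem_sup.1 h2
  refine ⟨b₁, hb₁, ?_⟩
  have : x * (b - b₁) = s + w + x * k₁ := by
    rw [mul_sub, ← huw]; ring
  rw [this]
  exact K.add_mem (K.add_mem hsK hw) (K.mul_mem_left _ hk₁)

/-- For a superficial sequence generating an `𝔪`-primary ideal `J`,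
`𝔪 ^ (n + 1) = J 𝔪 ^ n` modulo every initial segment, for large `n`. -/
theorem exists_pow_succ_le_mul_pow_sup (y : ℕ → R) {d : ℕ}
    (hy : ∀ j < d, SuperficialMod 𝔪 (initialIdeal y j) (y j))
    (hd : ∃ N, 𝔪 ^ N ≤ initialIdeal y d) {i : ℕ} (hi : i ≤ d) :
    ∃ N : ℕ, ∀ n, N ≤ n → 𝔪 ^ (n + 1) ≤ initialIdeal y d * 𝔪 ^ n ⊔ initialIdeal y i := by
  induction hi using Nat.decreasingInduction with
  | self =>
    obtain ⟨N, hN⟩ := hd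
    exact ⟨N, fun n hn => ((Ideal.pow_le_pow_right (by omega)).trans hN).trans le_sup_right⟩
  | of_succ i hi ih =>
    obtain ⟨N₁, h₁⟩ := ih
    obtain ⟨N₂, h₂⟩ := (hy i hi).exists_of_mul_mem
    refine ⟨max N₁ N₂, fun n hn z hz => ?_⟩
    have hz' := h₁ n (by omega) hz
    obtain ⟨p, hp, q, hq, rfl⟩ := Submodule.mem_sup.1 hz'
    rw [initialIdeal_succ] at hq
    obtain ⟨k, hk, t, ht, rfl⟩ := Submodule.mem_sup.1 hq
    obtain ⟨b, rfl⟩ := Ideal.mem_span_singleton'.1 ht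
    -- Superficiality replaces the coefficient `b` of `y i` by some `b' ∈ 𝔪 ^ n`; the error falls
    -- into the smaller ideal `initialIdeal y i`.
    obtain ⟨b', hb', hbK⟩ := h₂ n (by omega) b (by
      have : y i * b = (p + (k + b * y i)) - p - k := by ring
      rw [this]
      refine Ideal.sub_mem _ (Ideal.sub_mem _ (Ideal.mem_sup_left hz) (Ideal.mem_sup_left ?_))
        (Ideal.mem_sup_right hk)
      rw [pow_succ']
      refine Ideal.mul_mono_left (initialIdeal_le fun j hj => (hy j hj).1) hp)
    have : p + (k + b * y i) = (p + y i * b') + (k + y i * (b - b')) := by ring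
    rw [this]
    exact Submodule.add_mem_sup (Ideal.add_mem _ hp (Ideal.mul_mem_mul (mem_initialIdeal y hi) hb'))
      (Ideal.add_mem _ hk hbK)

end Local

/-! ### Regular sequences of linear forms in the associated graded ring -/

section

variable {R : Type u} [CommRing R] {m : Ideal R}

/-- The element `a t ^ n` of the Rees algebra. -/
def reesMonomial (n : ℕ) {a : R} (ha : a ∈ m ^ n) : reesAlgebra m :=
  ⟨monomial n a, reesAlgebra.monomial_mem.2 ha⟩

/-- The class in degree one of the associated graded ring of an element of `m`
(`0` for elements not in `m`). -/
def initialForm (m : Ideal R) (a : R) : AssociatedGradedRing m :=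
  open Classical in
  if ha : a ∈ m ^ 1 then Ideal.Quotient.mk (reesShift m) (reesMonomial 1 ha) else 0

/-- The sequence of linear initial forms of a sequence. -/
def initialForms (m : Ideal R) (y : ℕ → R) : ℕ → AssociatedGradedRing m :=
  fun j => initialForm m (y j)

theorem initialForm_of_mem {a : R} (ha : a ∈ m) :
    initialForm m a = Ideal.Quotient.mk (reesShift m)
      (reesMonomial 1 (by rwa [pow_one] : a ∈ m ^ 1)) := by
  rw [initialForm, dif_pos]

/-- The ideal of the Rees algebra of all `f` with `f_n ∈ K m ^ (n - 1) + m ^ (n + 1)`. -/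
def reesInitial (m K : Ideal R) : Ideal (reesAlgebra m) where
  carrier := {f | ∀ n, (f : R[X]).coeff n ∈ K * m ^ (n - 1) ⊔ m ^ (n + 1)}
  zero_mem' n := by simp
  add_mem' {f g} hf hg n := by
    simpa using Ideal.add_mem _ (hf n) (hg n)
  smul_mem' f g hg n := by
    have : (f • g : reesAlgebra m).1 = (f : R[X]) * (g : R[X]) := rfl
    rw [this, Polynomial.coeff_mul]
    refine Ideal.sum_mem _ ?_
    rintro ⟨i, j⟩ hij
    have hn : i + j = n := by simpa using hij
    have h1 := Ideal.mul_mem_mul (f.2 i) (hg j)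
    rw [Ideal.mul_sup, mul_left_comm, ← pow_add, ← pow_add] at h1
    have h2 : K * m ^ (i + (j - 1)) ⊔ m ^ (i + (j + 1)) ≤ K * m ^ (n - 1) ⊔ m ^ (n + 1) :=
      sup_le_sup (Ideal.mul_mono_right (Ideal.pow_le_pow_right (by omega)))
        (Ideal.pow_le_pow_right (by omega))
    exact h2 h1

theorem reesMonomial_mem_reesShift {n : ℕ} {a : R} (ha : a ∈ m ^ (n + 1)) :
    reesMonomial n (Ideal.pow_le_pow_right n.le_succ ha) ∈ reesShift m := by
  intro k
  change (monomial n a).coeff k ∈ _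
  rw [coeff_monomial]
  split_ifs with h
  · exact h ▸ ha
  · exact zero_mem _

theorem reesMonomial_add {n : ℕ} {a b : R} (ha : a ∈ m ^ n) (hb : b ∈ m ^ n) :
    reesMonomial n (add_mem ha hb) = reesMonomial n ha + reesMonomial n hb :=
  Subtype.ext (map_add _ _ _)

theorem reesMonomial_mul {k n : ℕ} {a b : R} (ha : a ∈ m ^ k) (hb : b ∈ m ^ n) :
    reesMonomial k ha * reesMonomial n hb =
      reesMonomial (k + n) (by rw [pow_add]; exact Ideal.mul_mem_mul ha hb : a * b ∈ m ^ (k + n)) :=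
  Subtype.ext (monomial_mul_monomial _ _ _ _)

theorem eq_sum_reesMonomial (f : reesAlgebra m) :
    f = ∑ n ∈ (f : R[X]).support, reesMonomial n (f.2 n) := by
  refine Subtype.ext ?_
  rw [AddSubmonoidClass.coe_finsetSum]
  exact (f : R[X]).as_sum_support

theorem initialIdeal_initialForm_le (y : ℕ → R) (i : ℕ) (hy : ∀ j < i, y j ∈ m)
    {f : reesAlgebra m}
    (hf : Ideal.Quotient.mk (reesShift m) f ∈ initialIdeal (initialForms m y) i) :
    f ∈ reesInitial m (initialIdeal y i) := by
  have h1 : initialIdeal (initialForms m y) i ≤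
      (reesInitial m (initialIdeal y i)).map (Ideal.Quotient.mk (reesShift m)) := by
    refine initialIdeal_le fun j hj => ?_
    rw [initialForms, initialForm_of_mem (hy j hj)]
    refine Ideal.mem_map_of_mem _ fun n => ?_
    change (monomial 1 (y j)).coeff n ∈ _
    rw [coeff_monomial]
    split_ifs with h
    · subst h
      exact Ideal.mem_sup_left (by simpa using mem_initialIdeal y hj)
    · exact zero_mem _
  have h2 := h1 hf
  rw [Ideal.mem_quotient_iff_mem_sup, sup_eq_left.2] at h2
  · exact h2
  · exact fun g hg n => Ideal.mem_sup_right (hg n)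

theorem reesMonomial_mem_initialIdeal (y : ℕ → R) (i : ℕ) (hy : ∀ j < i, y j ∈ m) {n : ℕ} {a : R}
    (ha : a ∈ m ^ n) (ha' : a ∈ initialIdeal y i * m ^ (n - 1)) :
    Ideal.Quotient.mk (reesShift m) (reesMonomial n ha) ∈
      initialIdeal (initialForms m y) i := by
  -- In degree zero `n - 1` truncates to `0`; the coefficient then lies in `initialIdeal y i ≤ m`,
  -- so its class vanishes.
  obtain rfl | hn := n.eq_zero_or_pos
  · rw [Ideal.Quotient.eq_zero_iff_mem.2]
    · exact zero_mem _
    · refine reesMonomial_mem_reesShift ?_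
      simpa using initialIdeal_le hy (Ideal.mul_le_left ha')
  obtain ⟨n, rfl⟩ : ∃ k, n = k + 1 := ⟨n - 1, by omega⟩
  rw [Nat.add_sub_cancel] at ha'
  induction i generalizing a with
  | zero =>
    obtain rfl : a = 0 := by simpa using ha'
    rw [Ideal.Quotient.eq_zero_iff_mem.2]
    · exact zero_mem _
    · exact reesMonomial_mem_reesShift (zero_mem _)
  | succ i ih =>
    rw [initialIdeal_succ, Ideal.sup_mul] at ha'
    obtain ⟨b, hb, c, hc, rfl⟩ := Submodule.mem_sup.1 ha'
    obtain ⟨w, hw, rfl⟩ := Ideal.mem_span_singleton_mul.1 hc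
    have hb' : b ∈ m ^ (n + 1) := by
      rw [pow_succ']
      exact Ideal.mul_mono_left (initialIdeal_le fun j hj => hy j (hj.trans i.lt_succ_self)) hb
    have hc' : y i * w ∈ m ^ (n + 1) := by
      rw [pow_succ']
      exact Ideal.mul_mem_mul (hy i i.lt_succ_self) hw
    rw [reesMonomial_add hb' hc', map_add, initialIdeal_succ]
    refine Submodule.add_mem_sup
      (ih (fun j hj => hy j (hj.trans i.lt_succ_self)) hb' hb) ?_
    refine Ideal.mem_span_singleton.2 ⟨Ideal.Quotient.mk _ (reesMonomial n hw), ?_⟩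
    rw [initialForms, initialForm_of_mem (hy i i.lt_succ_self), ← map_mul, reesMonomial_mul]
    congr 1
    refine Subtype.ext ?_
    change monomial (n + 1) _ = monomial (1 + n) _
    rw [add_comm]

/-- Membership in the ideal generated by linear initial forms is a condition on coefficients. -/
theorem mk_mem_initialIdeal_iff (y : ℕ → R) (i : ℕ) (hy : ∀ j < i, y j ∈ m)
    (f : reesAlgebra m) :
    Ideal.Quotient.mk (reesShift m) f ∈ initialIdeal (initialForms m y) i ↔
      ∀ n, (f : R[X]).coeff n ∈ initialIdeal y i * m ^ (n - 1) ⊔ m ^ (n + 1) := by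
  refine ⟨initialIdeal_initialForm_le y i hy, fun h => ?_⟩
  rw [eq_sum_reesMonomial f, map_sum]
  refine Ideal.sum_mem _ fun n _ => ?_
  obtain ⟨b, hb, c, hc, hbc⟩ := Submodule.mem_sup.1 (h n)
  have hc' := Ideal.pow_le_pow_right n.le_succ hc
  have hb' : b ∈ m ^ n := by
    rw [← eq_sub_iff_add_eq] at hbc
    rw [hbc]
    exact Ideal.sub_mem _ (f.2 n) hc'
  have : reesMonomial n (f.2 n) = reesMonomial n hb' + reesMonomial n hc' := by
    rw [← reesMonomial_add]
    exact Subtype.ext (congrArg (monomial n) hbc.symm)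
  rw [this, map_add, Ideal.Quotient.eq_zero_iff_mem.2 (reesMonomial_mem_reesShift hc), add_zero]
  exact reesMonomial_mem_initialIdeal y i hy hb' hb

theorem coeff_reesMonomial_mul {k : ℕ} {a : R} (ha : a ∈ m ^ k) (f : reesAlgebra m) (n : ℕ) :
    ((reesMonomial k ha * f : reesAlgebra m) : R[X]).coeff (n + k) = a * (f : R[X]).coeff n := by
  change (monomial k a * (f : R[X])).coeff (n + k) = _
  rw [← C_mul_X_pow_eq_monomial, mul_assoc, coeff_C_mul, coeff_X_pow_mul]

/-- Membership in the ideal of initial forms is coefficientwise and a degree-one monomial shifts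
coefficients by one, so regularity can be tested on homogeneous elements. -/
theorem regularMod_initialForm_iff (y : ℕ → R) (i : ℕ) (hy : ∀ j ≤ i, y j ∈ m) :
    RegularMod (initialIdeal (initialForms m y) i) (initialForm m (y i)) ↔
      ∀ n, ∀ a ∈ m ^ n, y i * a ∈ initialIdeal y i * m ^ n ⊔ m ^ (n + 2) →
        a ∈ initialIdeal y i * m ^ (n - 1) ⊔ m ^ (n + 1) := by
  have hy' : ∀ j < i, y j ∈ m := fun j hj => hy j hj.le
  constructor
  · intro h n a ha hya
    have h1 := h (Ideal.Quotient.mk _ (reesMonomial n ha)) (by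
      rw [initialForm_of_mem (hy i le_rfl), ← map_mul, reesMonomial_mul,
        mk_mem_initialIdeal_iff y i hy']
      intro k
      change (monomial (1 + n) (y i * a)).coeff k ∈ _
      rw [coeff_monomial]
      split_ifs with h
      · subst h
        simpa [add_comm, add_left_comm, add_assoc] using hya
      · exact zero_mem _)
    rw [mk_mem_initialIdeal_iff y i hy'] at h1
    have h2 := h1 n
    change (monomial n a).coeff n ∈ _ at h2
    rwa [coeff_monomial, if_pos rfl] at h2
  · intro h z hz
    obtain ⟨f, rfl⟩ := Ideal.Quotient.mk_surjective z
    rw [mk_mem_initialIdeal_iff y i hy']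
    rw [initialForm_of_mem (hy i le_rfl), ← map_mul, mk_mem_initialIdeal_iff y i hy'] at hz
    intro n
    have := hz (n + 1)
    rw [coeff_reesMonomial_mul] at this
    exact h n _ (f.2 n) this

theorem initialForm_mem_grIrrelevant {a : R} (ha : a ∈ m) :
    initialForm m a ∈ grIrrelevant m := by
  rw [initialForm_of_mem ha]
  refine Ideal.mem_map_of_mem _ ?_
  change constantCoeff (monomial 1 a) ∈ m
  simp [constantCoeff_apply, coeff_monomial]

theorem mk_mem_grIrrelevant {f : reesAlgebra m} :
    Ideal.Quotient.mk (reesShift m) f ∈ grIrrelevant m ↔ (f : R[X]).coeff 0 ∈ m := by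
  rw [grIrrelevant, Ideal.mem_quotient_iff_mem_sup, sup_eq_left.2]
  · rfl
  · intro g hg
    have := hg 0
    rw [zero_add, pow_one] at this
    exact this

theorem grIrrelevant_ne_top (hm : m ≠ ⊤) : grIrrelevant m ≠ ⊤ := by
  rw [Ne, Ideal.eq_top_iff_one] at hm ⊢
  rw [← map_one (Ideal.Quotient.mk (reesShift m)), mk_mem_grIrrelevant]
  simpa using hm

/-- A regular element of the irrelevant ideal need not be homogeneous; what is needed of it is that
its `c`-th power has no component below degree `c` in the graded ring. -/
theorem coeff_pow_mem_of_coeff_zero_mem {f : reesAlgebra m} (hf : (f : R[X]).coeff 0 ∈ m) (c : ℕ) :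
    ∀ n < c, ((f ^ c : reesAlgebra m) : R[X]).coeff n ∈ m ^ (n + 1) := by
  induction c with
  | zero => intro n hn; omega
  | succ c ih =>
    intro n hn
    have : ((f ^ (c + 1) : reesAlgebra m) : R[X]) =
        ((f ^ c : reesAlgebra m) : R[X]) * (f : R[X]) := by
      rw [pow_succ]; rfl
    rw [this, coeff_mul]
    refine Ideal.sum_mem _ ?_
    rintro ⟨p, q⟩ hpq
    have hpq' : p + q = n := by simpa using hpq
    by_cases hp : p < c
    · have := Ideal.mul_mem_mul (ih p hp) (f.2 q)
      rw [← pow_add] at this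
      exact Ideal.pow_le_pow_right (by omega) this
    · obtain rfl : q = 0 := by omega
      have := Ideal.mul_mem_mul ((f ^ c).2 p) hf
      rw [← pow_succ] at this
      exact Ideal.pow_le_pow_right (by omega) this

/-- If `y_i` is superficial modulo `(y_0, …, y_{i-1})`, and the initial forms of
`y_0, …, y_{i-1}` generate the initial ideal, then the initial form of `y_i` is regular as soon as
there is a regular element in the irrelevant ideal. -/
theorem SuperficialMod.regularMod_initialForm (y : ℕ → R) (i : ℕ) (hy : ∀ j ≤ i, y j ∈ m)
    (hs : SuperficialMod m (initialIdeal y i) (y i))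
    (hi : ∀ n, initialIdeal y i ⊓ m ^ (n + 1) ≤ initialIdeal y i * m ^ n)
    {z : AssociatedGradedRing m} (hz : z ∈ grIrrelevant m)
    (hzr : RegularMod (initialIdeal (initialForms m y) i) z) :
    RegularMod (initialIdeal (initialForms m y) i) (initialForm m (y i)) := by
  have hy' : ∀ j < i, y j ∈ m := fun j hj => hy j hj.le
  rw [regularMod_initialForm_iff y i hy]
  obtain ⟨-, c, hc⟩ := hs
  -- In degrees at least `c`, superficiality and the strictness `hi` suffice.
  have key : ∀ n, c ≤ n → ∀ a ∈ m ^ n, y i * a ∈ initialIdeal y i * m ^ n ⊔ m ^ (n + 2) →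
      a ∈ initialIdeal y i * m ^ (n - 1) ⊔ m ^ (n + 1) := by
    intro n hn a ha hya
    have h1 := hc (n + 1) (by omega) a (Ideal.mem_sup_left (Ideal.pow_le_pow_right hn ha))
      (by
        have : initialIdeal y i * m ^ n ⊔ m ^ (n + 2) ≤ m ^ (n + 2) ⊔ initialIdeal y i :=
          sup_le (Ideal.mul_le_left.trans le_sup_right) le_sup_left
        exact this hya)
    obtain ⟨u, hu, k, hk, rfl⟩ := Submodule.mem_sup.1 h1
    have hkn : k ∈ m ^ n := by
      have := Ideal.sub_mem _ ha (Ideal.pow_le_pow_right n.le_succ hu)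
      rwa [add_sub_cancel_left] at this
    refine Ideal.add_mem _ (Ideal.mem_sup_right hu) (Ideal.mem_sup_left ?_)
    obtain rfl | hn0 := n.eq_zero_or_pos
    · simpa using hk
    · obtain ⟨n, rfl⟩ : ∃ l, n = l + 1 := ⟨n - 1, by omega⟩
      exact hi n ⟨hk, hkn⟩
  intro n a ha hya
  obtain ⟨g, rfl⟩ := Ideal.Quotient.mk_surjective z
  rw [mk_mem_grIrrelevant] at hz
  -- Low degrees reduce to high ones: multiply by the power `g ^ c`, apply `key` to each component,
  -- and cancel it by regularity.
  have h1 : Ideal.Quotient.mk (reesShift m) (reesMonomial n ha) ∈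
      initialIdeal (initialForms m y) i := by
    refine hzr.pow c _ ?_
    rw [← map_pow, ← map_mul, mk_mem_initialIdeal_iff y i hy', mul_comm]
    intro k
    by_cases hk : n ≤ k
    · obtain ⟨p, rfl⟩ : ∃ p, k = p + n := ⟨k - n, by omega⟩
      rw [coeff_reesMonomial_mul, mul_comm a]
      by_cases hp : p < c
      · have := Ideal.mul_mem_mul (coeff_pow_mem_of_coeff_zero_mem hz c p hp) ha
        rw [← pow_add] at this
        exact Ideal.mem_sup_right (Ideal.pow_le_pow_right
          (by omega : p + n + 1 ≤ p + 1 + n) this)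
      · refine key (p + n) (by omega) _ ?_ ?_
        · rw [pow_add]
          exact Ideal.mul_mem_mul ((g ^ c).2 p) ha
        · rw [mul_left_comm]
          have := Ideal.mul_mem_mul ((g ^ c).2 p) hya
          rw [Ideal.mul_sup, mul_left_comm, ← pow_add, ← pow_add] at this
          exact this
    · have : ((reesMonomial n ha * g ^ c : reesAlgebra m) : R[X]).coeff k = 0 := by
        change (monomial n a * ((g ^ c : reesAlgebra m) : R[X])).coeff k = _
        rw [← C_mul_X_pow_eq_monomial, mul_assoc, coeff_C_mul, coeff_X_pow_mul', if_neg hk,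
          mul_zero]
      rw [this]
      exact zero_mem _
  rw [mk_mem_initialIdeal_iff y i hy'] at h1
  have h2 := h1 n
  change (monomial n a).coeff n ∈ _ at h2
  rwa [coeff_monomial, if_pos rfl] at h2

/-- The inductive step of the Valabrega–Valla criterion: from a strict sequence of length `i` and a
regular initial form, `(m ^ (n + 1) + K_i) : y_i = m ^ n + K_i`. -/
theorem mem_pow_sup_of_mul_mem (y : ℕ → R) (i : ℕ)
    (hi : ∀ n, initialIdeal y i ⊓ m ^ (n + 1) ≤ initialIdeal y i * m ^ n)
    (hr : ∀ n, ∀ a ∈ m ^ n, y i * a ∈ initialIdeal y i * m ^ n ⊔ m ^ (n + 2) →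
        a ∈ initialIdeal y i * m ^ (n - 1) ⊔ m ^ (n + 1))
    (hyi : y i ∈ m) (n : ℕ) (b : R) (hb : y i * b ∈ m ^ (n + 1) ⊔ initialIdeal y i) :
    b ∈ m ^ n ⊔ initialIdeal y i := by
  -- The order of a representative of `b` modulo `initialIdeal y i` is raised one step at a time.
  suffices ∀ j ≤ n, b ∈ m ^ j ⊔ initialIdeal y i from this n le_rfl
  intro j
  induction j with
  | zero => intro _; simp
  | succ j ih =>
    intro hj
    obtain ⟨a, ha, k, hk, rfl⟩ := Submodule.mem_sup.1 (ih (by omega))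
    obtain ⟨u, hu, w, hw, huw⟩ := Submodule.mem_sup.1 hb
    have hu' : u ∈ m ^ (j + 2) := Ideal.pow_le_pow_right (by omega) hu
    have hya : y i * a = (w - y i * k) + u := by
      rw [mul_add] at huw
      linear_combination -huw
    have hK : w - y i * k ∈ initialIdeal y i := Ideal.sub_mem _ hw (Ideal.mul_mem_left _ _ hk)
    have hm : w - y i * k ∈ m ^ (j + 1) := by
      have : w - y i * k = y i * a - u := by rw [hya]; ring
      rw [this]
      refine Ideal.sub_mem _ ?_ (Ideal.pow_le_pow_right (by omega) hu')
      rw [pow_succ']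
      exact Ideal.mul_mem_mul hyi ha
    have h1 := hr j a ha (by rw [hya]; exact Submodule.add_mem_sup (hi j ⟨hK, hm⟩) hu')
    refine Ideal.add_mem _ ?_ (Ideal.mem_sup_right hk)
    have : initialIdeal y i * m ^ (j - 1) ⊔ m ^ (j + 1) ≤ m ^ (j + 1) ⊔ initialIdeal y i :=
      sup_le (Ideal.mul_le_left.trans le_sup_right) le_sup_left
    exact this h1

/-- The colon condition lets the coefficient of `y i` be taken in `m ^ n`; the remainder lies in the
previous ideal, where strictness is known. -/
theorem initialIdeal_succ_inf_pow_le (y : ℕ → R) (i : ℕ)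
    (hi : ∀ n, initialIdeal y i ⊓ m ^ (n + 1) ≤ initialIdeal y i * m ^ n)
    (hr : ∀ n b, y i * b ∈ m ^ (n + 1) ⊔ initialIdeal y i → b ∈ m ^ n ⊔ initialIdeal y i)
    (hyi : y i ∈ m) (n : ℕ) :
    initialIdeal y (i + 1) ⊓ m ^ (n + 1) ≤ initialIdeal y (i + 1) * m ^ n := by
  rintro z ⟨hz, hzm⟩
  rw [initialIdeal_succ] at hz
  obtain ⟨k, hk, t, ht, rfl⟩ := Submodule.mem_sup.1 hz
  obtain ⟨b, rfl⟩ := Ideal.mem_span_singleton'.1 ht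
  have hb := hr n b (by
    have : y i * b = (k + b * y i) - k := by ring
    rw [this]
    exact Ideal.sub_mem _ (Ideal.mem_sup_left hzm) (Ideal.mem_sup_right hk))
  obtain ⟨c, hc, l, hl, rfl⟩ := Submodule.mem_sup.1 hb
  have hyc : y i * c ∈ m ^ (n + 1) := by
    rw [pow_succ']
    exact Ideal.mul_mem_mul hyi hc
  have : k + (c + l) * y i = (k + l * y i) + y i * c := by ring
  rw [this] at hzm ⊢
  refine Ideal.add_mem _ ?_ (Ideal.mul_mem_mul (mem_initialIdeal y i.lt_succ_self) hc)
  refine Ideal.mul_mono_left (initialIdeal_mono y i.le_succ) (hi n ⟨?_, ?_⟩)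
  · exact Ideal.add_mem _ hk (Ideal.mul_mem_right _ _ hl)
  · have := Ideal.sub_mem _ hzm hyc
    rwa [add_sub_cancel_right] at this

/-- If the part of `K_i` in `m ^ (n + 1)` lies in `K_{i+1} m ^ n`, it lies in `K_i m ^ n`. -/
theorem inf_pow_le_of_inf_pow_le_succ (y : ℕ → R) (i : ℕ)
    (hreg : RegularMod (initialIdeal y i) (y i)) (hym : ∀ j ≤ i, y j ∈ m)
    (h : ∀ n, initialIdeal y i ⊓ m ^ (n + 1) ≤ initialIdeal y (i + 1) * m ^ n) (n : ℕ) :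
    initialIdeal y i ⊓ m ^ (n + 1) ≤ initialIdeal y i * m ^ n := by
  induction n with
  | zero => simp
  | succ n ih =>
    rintro z ⟨hzK, hzm⟩
    have h1 := h (n + 1) ⟨hzK, hzm⟩
    rw [initialIdeal_succ, Ideal.sup_mul] at h1
    obtain ⟨k, hk, t, ht, rfl⟩ := Submodule.mem_sup.1 h1
    obtain ⟨b, hb, rfl⟩ := Ideal.mem_span_singleton_mul.1 ht
    -- Cancelling `y i` puts `b` in the same intersection one degree lower, where the induction
    -- hypothesis applies.
    have hbK : b ∈ initialIdeal y i := hreg b (by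
      have := Ideal.sub_mem _ hzK (Ideal.mul_le_left hk)
      rwa [add_sub_cancel_left] at this)
    refine Ideal.add_mem _ hk ?_
    have h2 := Ideal.mul_mem_mul (hym i le_rfl) (ih ⟨hbK, hb⟩)
    rwa [mul_left_comm, ← pow_succ'] at h2

/-- Strict regular sequences have regular initial forms. -/
theorem regularMod_initialForm_of_inf_pow_le (y : ℕ → R) (i : ℕ) (hym : ∀ j ≤ i, y j ∈ m)
    (hreg : RegularMod (initialIdeal y i) (y i))
    (hi : ∀ n, initialIdeal y i ⊓ m ^ (n + 1) ≤ initialIdeal y i * m ^ n)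
    (hi' : ∀ n, initialIdeal y (i + 1) ⊓ m ^ (n + 1) ≤ initialIdeal y (i + 1) * m ^ n) :
    RegularMod (initialIdeal (initialForms m y) i) (initialForm m (y i)) := by
  rw [regularMod_initialForm_iff y i hym]
  intro n a ha hya
  obtain ⟨u, hu, v, hv, huv⟩ := Submodule.mem_sup.1 hya
  have huK := Ideal.mul_le_left hu
  have hv' := hi' (n + 1) ⟨by
    have : v = y i * a - u := by rw [← huv]; ring
    rw [this]
    exact Ideal.sub_mem _ (Ideal.mul_mem_right _ _ (mem_initialIdeal y i.lt_succ_self))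
      (initialIdeal_mono y i.le_succ huK), hv⟩
  rw [initialIdeal_succ, Ideal.sup_mul] at hv'
  obtain ⟨k, hk, t, ht, rfl⟩ := Submodule.mem_sup.1 hv'
  obtain ⟨w, hw, rfl⟩ := Ideal.mem_span_singleton_mul.1 ht
  have haw : a - w ∈ initialIdeal y i := hreg _ (by
    have : y i * (a - w) = u + k := by linear_combination -huv
    rw [this]
    exact Ideal.add_mem _ huK (Ideal.mul_le_left hk))
  have : a = (a - w) + w := by ring
  rw [this]
  refine Submodule.add_mem_sup ?_ hw
  have hawm : a - w ∈ m ^ n := Ideal.sub_mem _ ha (Ideal.pow_le_pow_right n.le_succ hw)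
  obtain rfl | hn0 := n.eq_zero_or_pos
  · simpa using haw
  · obtain ⟨n, rfl⟩ : ∃ l, n = l + 1 := ⟨n - 1, by omega⟩
    exact hi n ⟨haw, hawm⟩

theorem exists_regularMod_of_lt_ringDepth_grIrrelevant [IsNoetherianRing R] (hm : m ≠ ⊤) {k : ℕ}
    (h : (k : ℕ∞) ≤ ringDepth (A := AssociatedGradedRing m) (grIrrelevant m))
    (y : ℕ → AssociatedGradedRing m) {i : ℕ} (hik : i < k)
    (hy : ∀ j < i, RegularMod (initialIdeal y j) (y j)) :
    ∃ z ∈ grIrrelevant m, RegularMod (initialIdeal y i) z := by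
  have hm' : (grIrrelevant m :
    @Ideal (AssociatedGradedRing m) CommRing.toCommSemiring.toSemiring) ≠ ⊤ :=
    grIrrelevant_ne_top hm
  exact exists_regularMod_of_lt_idealDepth (A := AssociatedGradedRing m) hm' h y hik hy

theorem le_ringDepth_grIrrelevant_of_regularMod (hm : m ≠ ⊤) (y : ℕ → AssociatedGradedRing m)
    (i : ℕ) (hyI : ∀ j < i, y j ∈ grIrrelevant m)
    (hy : ∀ j < i, RegularMod (initialIdeal y j) (y j)) :
    (i : ℕ∞) ≤ ringDepth (A := AssociatedGradedRing m) (grIrrelevant m) := by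
  have hm' : (grIrrelevant m :
    @Ideal (AssociatedGradedRing m) CommRing.toCommSemiring.toSemiring) ≠ ⊤ :=
    grIrrelevant_ne_top hm
  exact le_idealDepth_of_regularMod (A := AssociatedGradedRing m) hm' y i hyI hy

/-- Superficial sequences are strict up to the depth of the associated graded ring. -/
theorem inf_pow_le_of_le_ringDepth_grIrrelevant [IsNoetherianRing R] (hm : m ≠ ⊤) {k : ℕ}
    (h : (k : ℕ∞) ≤ ringDepth (A := AssociatedGradedRing m) (grIrrelevant m)) (y : ℕ → R)
    (hy : ∀ j < k, SuperficialMod m (initialIdeal y j) (y j)) :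
    (∀ i ≤ k, ∀ n, initialIdeal y i ⊓ m ^ (n + 1) ≤ initialIdeal y i * m ^ n) ∧
    ∀ i < k, ∀ n b, y i * b ∈ m ^ (n + 1) ⊔ initialIdeal y i → b ∈ m ^ n ⊔ initialIdeal y i := by
  -- The three properties need one joint induction: strictness with depth makes the next initial
  -- form regular, this gives the colon condition, and that gives strictness of the next ideal.
  have main : ∀ i ≤ k,
      (∀ n, initialIdeal y i ⊓ m ^ (n + 1) ≤ initialIdeal y i * m ^ n) ∧
      (∀ j < i, RegularMod (initialIdeal (initialForms m y) j)
        (initialForms m y j)) ∧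
      ∀ j < i, ∀ n b, y j * b ∈ m ^ (n + 1) ⊔ initialIdeal y j →
        b ∈ m ^ n ⊔ initialIdeal y j := by
    intro i
    induction i with
    | zero => intro _; simp
    | succ i ih =>
      intro hi
      obtain ⟨h1, h2, h3⟩ := ih (by omega)
      have hym : ∀ j ≤ i, y j ∈ m := fun j hj => (hy j (by omega)).1
      obtain ⟨z, hz, hzr⟩ := exists_regularMod_of_lt_ringDepth_grIrrelevant hm h
        (initialForms m y) (by omega : i < k) h2
      have h4 := (hy i (by omega)).regularMod_initialForm y i hym h1 hz hzr
      have h5 := mem_pow_sup_of_mul_mem y i h1 ((regularMod_initialForm_iff y i hym).1 h4)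
        (hym i le_rfl)
      refine ⟨initialIdeal_succ_inf_pow_le y i h1 h5 (hym i le_rfl), fun j hj => ?_,
        fun j hj => ?_⟩
      · obtain hj' | rfl := Nat.lt_succ_iff_lt_or_eq.1 hj
        · exact h2 j hj'
        · exact h4
      · obtain hj' | rfl := Nat.lt_succ_iff_lt_or_eq.1 hj
        · exact h3 j hj'
        · exact h5
  exact ⟨fun i hi => (main i hi).1, (main k le_rfl).2.2⟩

/-- The hypothesis only bounds the top intersection by the larger ideal; regularity of the `y j`
sharpens it and carries it down to all initial segments, whose initial forms are then regular. -/
theorem le_ringDepth_grIrrelevant_of_inf_pow_le (hm : m ≠ ⊤) (k : ℕ) (y : ℕ → R)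
    (hym : ∀ j ≤ k, y j ∈ m)
    (hreg : ∀ j ≤ k, RegularMod (initialIdeal y j) (y j))
    (h : ∀ n, initialIdeal y k ⊓ m ^ (n + 1) ≤ initialIdeal y (k + 1) * m ^ n) :
    (k : ℕ∞) ≤ ringDepth (A := AssociatedGradedRing m) (grIrrelevant m) := by
  have h1 : ∀ i ≤ k, ∀ n, initialIdeal y i ⊓ m ^ (n + 1) ≤ initialIdeal y i * m ^ n := by
    intro i hi
    induction hi using Nat.decreasingInduction with
    | self => exact inf_pow_le_of_inf_pow_le_succ y k (hreg k le_rfl) hym h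
    | of_succ i hi ih =>
      exact inf_pow_le_of_inf_pow_le_succ y i (hreg i (by omega)) (fun j hj => hym j (by omega))
        fun n => (inf_le_inf_right _ (initialIdeal_mono y i.le_succ)).trans (ih n)
  exact le_ringDepth_grIrrelevant_of_regularMod hm (initialForms m y) k
    (fun j hj => initialForm_mem_grIrrelevant (hym j hj.le))
    fun j hj => regularMod_initialForm_of_inf_pow_le y j (fun l hl => hym l (by omega))
      (hreg j hj.le) (h1 j hj.le) (h1 (j + 1) hj)

end

theorem grDepth_eq_ringDepth (R : Type u) [CommRing R] [IsLocalRing R] :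
    grDepth R = ringDepth (A := AssociatedGradedRing (IsLocalRing.maximalIdeal R))
      (grIrrelevant (IsLocalRing.maximalIdeal R)) := by
  unfold grDepth ringDepth
  rfl

/-! ### Lengths of quotients of ideals -/

section

variable {R : Type u} [CommRing R]

section

variable {M : Type v} [AddCommGroup M] [Module R M]

theorem quotLength_eq_add {A B C : Submodule R M} (hCB : C ≤ B) (hBA : B ≤ A) :
    quotLength A C = quotLength B C + quotLength A B := by
  have hle : C.submoduleOf B ≤ (C.submoduleOf A).comap (Submodule.inclusion hBA) := fun _ h => h
  have hle' : C.submoduleOf A ≤ (B.submoduleOf A).comap LinearMap.id := fun _ h => hCB h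
  refine Module.length_eq_add_of_exact
    (Submodule.mapQ _ _ (Submodule.inclusion hBA) hle) (Submodule.mapQ _ _ LinearMap.id hle')
    ?_ ?_ ?_
  · rw [← LinearMap.ker_eq_bot, LinearMap.ker_eq_bot']
    intro a ha
    obtain ⟨b, rfl⟩ := Submodule.Quotient.mk_surjective _ a
    rw [Submodule.mapQ_apply, Submodule.Quotient.mk_eq_zero] at ha
    exact (Submodule.Quotient.mk_eq_zero _).2 ha
  · intro a
    obtain ⟨b, rfl⟩ := Submodule.Quotient.mk_surjective _ a
    exact ⟨Submodule.Quotient.mk b, rfl⟩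
  · intro a
    obtain ⟨b, rfl⟩ := Submodule.Quotient.mk_surjective _ a
    rw [Submodule.mapQ_apply, Submodule.Quotient.mk_eq_zero]
    constructor
    · intro hb
      exact ⟨Submodule.Quotient.mk ⟨b.1, hb⟩, rfl⟩
    · rintro ⟨c, hc⟩
      obtain ⟨c, rfl⟩ := Submodule.Quotient.mk_surjective _ c
      rw [Submodule.mapQ_apply, Submodule.Quotient.eq] at hc
      have h1 : (c : M) - (b : M) ∈ C := hc
      have h2 := B.sub_mem c.2 (hCB h1)
      rw [sub_sub_cancel] at h2
      exact h2

theorem quotLength_eq_zero_iff {A B : Submodule R M} : quotLength A B = 0 ↔ A ≤ B := by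
  rw [quotLength, Module.length_eq_zero_iff, Submodule.Quotient.subsingleton_iff,
    Submodule.submoduleOf_eq_top]

theorem quotLength_sup_right (A B : Submodule R M) :
    quotLength (A ⊔ B) B = quotLength A (A ⊓ B) :=
  (LinearMap.quotientInfEquivSupQuotient A B).symm.length_eq

/-- The natural-number-valued length of a quotient. -/
def natLength (A B : Submodule R M) : ℕ := (quotLength A B).toNat

theorem natLength_eq_add {A B C : Submodule R M} (hCB : C ≤ B) (hBA : B ≤ A)
    (h : quotLength A C ≠ ⊤) : natLength A C = natLength B C + natLength A B := by
  rw [quotLength_eq_add hCB hBA] at h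
  rw [natLength, quotLength_eq_add hCB hBA, ENat.toNat_add (fun h' => h (by simp [h']))
    (fun h' => h (by simp [h']))]
  rfl

theorem natLength_eq_zero {A B : Submodule R M} (h : A ≤ B) : natLength A B = 0 := by
  rw [natLength, quotLength_eq_zero_iff.2 h, ENat.toNat_zero]

theorem le_of_natLength_eq_zero {A B : Submodule R M} (h : quotLength A B ≠ ⊤)
    (h0 : natLength A B = 0) : A ≤ B := by
  rw [← quotLength_eq_zero_iff]
  exact (ENat.toNat_eq_zero.1 h0).resolve_right h

theorem natLength_sup_right (A B : Submodule R M) :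
    natLength (A ⊔ B) B = natLength A (A ⊓ B) := by
  rw [natLength, quotLength_sup_right, natLength]

theorem quotLength_ne_top_of_le {A B A' B' : Submodule R M} (hB : B ≤ B') (hA : A' ≤ A)
    (hBA : B' ≤ A') (h : quotLength A B ≠ ⊤) : quotLength A' B' ≠ ⊤ := by
  rw [quotLength_eq_add hB (hBA.trans hA), quotLength_eq_add hBA hA] at h
  intro h'
  simp [h'] at h

end

/-- The colon ideal `K : x`. -/
def colonElement (K : Ideal R) (x : R) : Ideal R :=
  Submodule.comap (LinearMap.mulLeft R x) K

theorem mem_colonElement {K : Ideal R} {x a : R} : a ∈ colonElement K x ↔ x * a ∈ K := Iff.rfl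

theorem le_colonElement (K : Ideal R) (x : R) : K ≤ colonElement K x :=
  fun _ ha => K.mul_mem_left _ ha

/-- Multiplication by `x` maps `R` onto the left-hand quotient with kernel `B ⊔ (K : x)`. -/
theorem quotLength_mul_left (K B : Ideal R) (x : R) :
    quotLength (Ideal.span {x} ⊔ K) (Ideal.span {x} * B ⊔ K) =
      quotLength ⊤ (B ⊔ colonElement K x) := by
  let f : (⊤ : Ideal R) →ₗ[R] (Ideal.span {x} ⊔ K : Ideal R) ⧸
      (Ideal.span {x} * B ⊔ K).submoduleOf (Ideal.span {x} ⊔ K) :=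
    (Submodule.mkQ _).comp <| LinearMap.codRestrict _ ((LinearMap.mulLeft R x).comp
      (Submodule.subtype ⊤)) fun a => Ideal.mem_sup_left
        (Ideal.mul_mem_right _ _ (Ideal.mem_span_singleton_self x))
  have hf : Function.Surjective f := by
    intro z
    obtain ⟨⟨z, hz⟩, rfl⟩ := Submodule.Quotient.mk_surjective _ z
    obtain ⟨t, ht, k, hk, rfl⟩ := Submodule.mem_sup.1 hz
    obtain ⟨b, rfl⟩ := Ideal.mem_span_singleton'.1 ht
    refine ⟨⟨b, trivial⟩, (Submodule.Quotient.eq _).2 ?_⟩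
    change x * b - (b * x + k) ∈ Ideal.span {x} * B ⊔ K
    have : x * b - (b * x + k) = -k := by ring
    rw [this]
    exact Ideal.mem_sup_right (neg_mem hk)
  have hk : LinearMap.ker f = (B ⊔ colonElement K x).submoduleOf ⊤ := by
    ext ⟨a, ha⟩
    rw [LinearMap.mem_ker]
    refine (Submodule.Quotient.mk_eq_zero _).trans ?_
    change x * a ∈ Ideal.span {x} * B ⊔ K ↔ a ∈ B ⊔ colonElement K x
    constructor
    · intro h
      obtain ⟨t, ht, k, hk, htk⟩ := Submodule.mem_sup.1 h
      obtain ⟨b, hb, rfl⟩ := Ideal.mem_span_singleton_mul.1 ht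
      refine Submodule.mem_sup.2 ⟨b, hb, a - b, ?_, by ring⟩
      rw [mem_colonElement]
      have : x * (a - b) = k := by linear_combination -htk
      rwa [this]
    · intro h
      obtain ⟨b, hb, k, hk, rfl⟩ := Submodule.mem_sup.1 h
      rw [mul_add]
      exact Submodule.add_mem_sup (Ideal.mul_mem_mul (Ideal.mem_span_singleton_self x) hb) hk
  rw [quotLength, quotLength, ← hk]
  exact (f.quotKerEquivOfSurjective hf).length_eq.symm

theorem quotLength_span_sup (L : Ideal R) (x : R) :
    quotLength (L ⊔ Ideal.span {x}) L = quotLength ⊤ (colonElement L x) := by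
  have := quotLength_mul_left L ⊥ x
  rwa [Ideal.mul_bot, bot_sup_eq, bot_sup_eq, sup_comm] at this

theorem pow_sup_le_colonElement {m K : Ideal R} {x : R} (hx : x ∈ m) (n : ℕ) :
    m ^ n ⊔ K ≤ colonElement (m ^ (n + 1) ⊔ K) x := by
  refine sup_le (fun a ha => ?_) (fun a ha => Ideal.mem_sup_right (K.mul_mem_left _ ha))
  rw [mem_colonElement, pow_succ']
  exact Ideal.mem_sup_left (Ideal.mul_mem_mul hx ha)

end

/-! ### Hilbert functions of quotients and their hyperplane sections. -/

section Local

variable {R : Type u} [CommRing R] [IsLocalRing R] [IsNoetherianRing R]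

local notation "𝔪" => IsLocalRing.maximalIdeal R

theorem quotLength_top_ne_top {A : Ideal R} {N : ℕ} (h : 𝔪 ^ N ≤ A) :
    quotLength (⊤ : Ideal R) A ≠ ⊤ := by
  have h1 : IsArtinianRing (R ⧸ A) := by
    cases subsingleton_or_nontrivial (R ⧸ A)
    · infer_instance
    have : IsLocalRing (R ⧸ A) := IsLocalRing.of_surjective' _ Ideal.Quotient.mk_surjective
    rw [isArtinianRing_iff_isNilpotent_maximalIdeal]
    refine ⟨N, ?_⟩
    rw [Ideal.zero_eq_bot, eq_bot_iff, ← Ideal.map_mk_eq_bot_of_le h, Ideal.map_pow]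
    rw [IsLocalRing.map_maximalIdeal_of_surjective _ Ideal.Quotient.mk_surjective]
  have h2 : Module.length R (R ⧸ A) ≠ ⊤ := by
    rw [Module.length_eq_of_surjective (R := R ⧸ A) (S := R) (M := R ⧸ A)
      Ideal.Quotient.mk_surjective]
    exact Module.length_ne_top
  have hle : A.submoduleOf ⊤ ≤ Submodule.comap (Submodule.subtype ⊤) A := fun _ h => h
  have h3 : quotLength (⊤ : Ideal R) A ≤ Module.length R (R ⧸ A) := by
    refine Module.length_le_of_injective
      (Submodule.mapQ _ _ (Submodule.subtype ⊤) hle) ?_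
    rw [← LinearMap.ker_eq_bot, LinearMap.ker_eq_bot']
    intro a ha
    obtain ⟨b, rfl⟩ := Submodule.Quotient.mk_surjective _ a
    rw [Submodule.mapQ_apply, Submodule.Quotient.mk_eq_zero] at ha
    exact (Submodule.Quotient.mk_eq_zero _).2 ha
  exact ne_top_of_le_ne_top h2 h3

theorem quotLength_ne_top {A B : Ideal R} (hBA : B ≤ A) {N : ℕ} (h : 𝔪 ^ N ≤ B) :
    quotLength A B ≠ ⊤ :=
  quotLength_ne_top_of_le le_rfl le_top hBA (quotLength_top_ne_top h)

/-- The Hilbert function of `R / K`. -/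
def hilbertFun (K : Ideal R) (n : ℕ) : ℕ :=
  natLength (𝔪 ^ n ⊔ K) (𝔪 ^ (n + 1) ⊔ K)

theorem natLength_top_eq_sum_hilbertFun (K : Ideal R) (n : ℕ) :
    natLength ⊤ (𝔪 ^ n ⊔ K) = ∑ j ∈ Finset.range n, hilbertFun K j := by
  induction n with
  | zero => simp [natLength_eq_zero]
  | succ n ih =>
    rw [Finset.sum_range_succ, ← ih, natLength_eq_add (A := ⊤) (B := 𝔪 ^ n ⊔ K)
      (sup_le_sup_right (Ideal.pow_le_pow_right n.le_succ) K) le_top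
      (quotLength_top_ne_top (N := n + 1) le_sup_left), add_comm, hilbertFun]

/-- Hilbert functions and hyperplane sections. -/
theorem sum_hilbertFun_sup_span (K : Ideal R) {x : R} (hx : x ∈ 𝔪) (n : ℕ) :
    ∑ j ∈ Finset.range (n + 1), hilbertFun (K ⊔ Ideal.span {x}) j =
      hilbertFun K n + natLength (colonElement (𝔪 ^ (n + 1) ⊔ K) x) (𝔪 ^ n ⊔ K) := by
  have h1 := natLength_eq_add (A := ⊤) (B := 𝔪 ^ (n + 1) ⊔ K ⊔ Ideal.span {x})
    (C := 𝔪 ^ (n + 1) ⊔ K) le_sup_left le_top (quotLength_top_ne_top (N := n + 1) le_sup_left)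
  have h2 := natLength_eq_add (A := ⊤) (B := colonElement (𝔪 ^ (n + 1) ⊔ K) x)
    (C := 𝔪 ^ n ⊔ K) (pow_sup_le_colonElement hx n) le_top
    (quotLength_top_ne_top (N := n) le_sup_left)
  -- Multiplication by `x` on `R ⧸ (𝔪 ^ (n + 1) ⊔ K)` links the two decompositions `h1` and `h2`.
  have h3 : natLength (𝔪 ^ (n + 1) ⊔ K ⊔ Ideal.span {x}) (𝔪 ^ (n + 1) ⊔ K) =
      natLength ⊤ (colonElement (𝔪 ^ (n + 1) ⊔ K) x) := by
    rw [natLength, quotLength_span_sup, natLength]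
  have h4 := natLength_top_eq_sum_hilbertFun K (n + 1)
  rw [Finset.sum_range_succ, ← natLength_top_eq_sum_hilbertFun] at h4
  rw [← natLength_top_eq_sum_hilbertFun, ← sup_assoc]
  omega

/-- Makes the correction terms of `sum_hilbertFun_sup_span` the coefficients of a polynomial. -/
theorem SuperficialMod.natLength_colonElement_eq_zero {K : Ideal R} {x : R}
    (h : SuperficialMod 𝔪 K x) (hr : RegularMod K x) :
    ∃ N : ℕ, ∀ n, N ≤ n → natLength (colonElement (𝔪 ^ (n + 1) ⊔ K) x) (𝔪 ^ n ⊔ K) = 0 := by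
  obtain ⟨N, hN⟩ := h.exists_of_mul_mem
  refine ⟨N, fun n hn => natLength_eq_zero fun b hb => ?_⟩
  obtain ⟨b', hb', hbb⟩ := hN n hn b hb
  have : b = b' + (b - b') := by ring
  rw [this]
  exact Submodule.add_mem_sup hb' (hr _ hbb)

theorem SuperficialMod.exists_colonElement_inf_eq {K : Ideal R} {x : R}
    (h : SuperficialMod 𝔪 K x) : ∃ c : ℕ, colonElement K x ⊓ (𝔪 ^ c ⊔ K) = K := by
  obtain ⟨c, hc⟩ := h.exists_mem_pow
  exact ⟨c, le_antisymm (fun a ha => hc a ha.2 ha.1) (le_inf (le_colonElement K x) le_sup_right)⟩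

/-- For the `c` of superficiality, `(K : x) / K` embeds in `R / (𝔪 ^ c ⊔ K)`, which has finite
length. -/
theorem SuperficialMod.quotLength_colonElement_ne_top {K : Ideal R} {x : R}
    (h : SuperficialMod 𝔪 K x) : quotLength (colonElement K x) K ≠ ⊤ := by
  obtain ⟨c, hc⟩ := h.exists_colonElement_inf_eq
  have h1 := quotLength_sup_right (colonElement K x) (𝔪 ^ c ⊔ K)
  rw [hc] at h1
  rw [← h1]
  exact quotLength_ne_top (N := c) le_sup_right le_sup_left

theorem SuperficialMod.quotLength_colonElement_inf_ne_top {K : Ideal R} {x : R}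
    (h : SuperficialMod 𝔪 K x) (n : ℕ) :
    quotLength (colonElement K x ⊓ (𝔪 ^ n ⊔ K)) K ≠ ⊤ :=
  quotLength_ne_top_of_le le_rfl inf_le_left (le_inf (le_colonElement K x) le_sup_right)
    h.quotLength_colonElement_ne_top

/-- The Hilbert function in dimension one: `H(n) = e - (v_n - w_n)`. -/
theorem SuperficialMod.exists_hilbertFun_eq {K : Ideal R} {x : R} (h : SuperficialMod 𝔪 K x)
    {N : ℕ} (hN : 𝔪 ^ N ≤ K ⊔ Ideal.span {x}) :
    ∃ e : ℤ, ∀ n, (hilbertFun K n : ℤ) = e -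
      ((natLength (𝔪 ^ (n + 1) ⊔ K) (Ideal.span {x} * 𝔪 ^ n ⊔ K) : ℤ) -
        natLength (colonElement K x ⊓ (𝔪 ^ n ⊔ K)) K) := by
  have hu : ∀ n, natLength (𝔪 ^ n ⊔ colonElement K x) (𝔪 ^ n ⊔ K) =
      natLength (colonElement K x) (colonElement K x ⊓ (𝔪 ^ n ⊔ K)) := by
    intro n
    rw [← natLength_sup_right]
    congr 1
    rw [sup_left_comm, sup_eq_left.2 (le_colonElement K x)]
  have hpow : ∀ n, ∃ k, 𝔪 ^ k ≤ Ideal.span {x} * 𝔪 ^ n ⊔ K := by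
    intro n
    refine ⟨N + n, ?_⟩
    rw [pow_add]
    refine (Ideal.mul_mono_left hN).trans ?_
    rw [Ideal.sup_mul]
    exact sup_le (Ideal.mul_le_left.trans le_sup_right) le_sup_left
  -- The length of `R / (x 𝔪 ^ n ⊔ K)` is computed through `𝔪 ^ (n + 1) ⊔ K` and through `K ⊔ (x)`;
  -- this constant collects what does not depend on `n`.
  refine ⟨natLength ⊤ (K ⊔ Ideal.span {x}) - natLength (colonElement K x) K, fun n => ?_⟩
  obtain ⟨k, hk⟩ := hpow n
  have hle : Ideal.span {x} * 𝔪 ^ n ⊔ K ≤ 𝔪 ^ (n + 1) ⊔ K := by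
    refine sup_le_sup_right ?_ K
    rw [pow_succ']
    exact Ideal.mul_mono_left ((Ideal.span_singleton_le_iff_mem _).2 h.1)
  have h1 := natLength_eq_add (A := ⊤) hle le_top (quotLength_top_ne_top hk)
  have h2 := natLength_eq_add (A := ⊤) (B := K ⊔ Ideal.span {x})
    (C := Ideal.span {x} * 𝔪 ^ n ⊔ K)
    (sup_le (Ideal.mul_le_left.trans le_sup_right) le_sup_left) le_top (quotLength_top_ne_top hk)
  have h3 : natLength (K ⊔ Ideal.span {x}) (Ideal.span {x} * 𝔪 ^ n ⊔ K) =
      natLength ⊤ (𝔪 ^ n ⊔ colonElement K x) := by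
    rw [natLength, sup_comm K, quotLength_mul_left, natLength]
  have h4 := natLength_eq_add (A := ⊤) (B := 𝔪 ^ n ⊔ K) (C := 𝔪 ^ (n + 1) ⊔ K)
      (sup_le_sup_right (Ideal.pow_le_pow_right n.le_succ) K) le_top
      (quotLength_top_ne_top (N := n + 1) le_sup_left)
  have h5 := natLength_eq_add (A := ⊤) (B := 𝔪 ^ n ⊔ colonElement K x) (C := 𝔪 ^ n ⊔ K)
    (sup_le_sup_left (le_colonElement K x) _) le_top (quotLength_top_ne_top (N := n) le_sup_left)
  have h6 := natLength_eq_add (A := colonElement K x) (B := colonElement K x ⊓ (𝔪 ^ n ⊔ K))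
    (C := K) (le_inf (le_colonElement K x) le_sup_right) inf_le_left
    h.quotLength_colonElement_ne_top
  have h7 := hu n
  rw [hilbertFun]
  omega

end Local

section Local

variable {R : Type u} [CommRing R] [IsLocalRing R]

local notation "𝔪" => IsLocalRing.maximalIdeal R

/-! ### Dimension -/

theorem isRegular_map_range (y : ℕ → R) {i : ℕ} (hym : ∀ j < i, y j ∈ 𝔪)
    (hreg : ∀ j < i, RegularMod (initialIdeal y j) (y j)) :
    RingTheory.Sequence.IsRegular R ((List.range i).map y) := by
  refine ⟨(isWeaklyRegular_map_range_iff y i).2 hreg, fun h => ?_⟩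
  refine (IsLocalRing.maximalIdeal.isMaximal R).ne_top (top_le_iff.1 ?_)
  rw [h, smul_eq_mul, Ideal.mul_top]
  exact initialIdeal_le hym

/-- Only units `a` are missed by the left side, and a unit in `K : x` would force `K = 𝔪`, against
dimension one. Hence the term with `n = 1` already detects regularity. -/
theorem colonElement_inf_le_iff_regularMod {K : Ideal R} {x : R}
    (hK : ringKrullDim (R ⧸ K) = 1) :
    colonElement K x ⊓ (𝔪 ^ 1 ⊔ K) ≤ K ↔ RegularMod K x := by
  refine ⟨fun h1 a ha => ?_, fun h1 a ha => h1 a ha.1⟩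
  by_cases ham : a ∈ 𝔪
  · exact h1 ⟨ha, Ideal.mem_sup_left (by rwa [pow_one])⟩
  · exfalso
    have hxK : x ∈ K := (Ideal.mul_unit_mem_iff_mem K
      (by simpa using ham : IsUnit a)).1 ha
    have hmK : 𝔪 ≤ K := fun b hb =>
      h1 ⟨K.mul_mem_right _ hxK, Ideal.mem_sup_left (by rwa [pow_one])⟩
    have hKtop : K ≠ ⊤ := by
      rintro rfl
      rw [ringKrullDim_eq_bot_of_subsingleton] at hK
      exact absurd hK (by simp)
    obtain rfl : K = 𝔪 := le_antisymm (IsLocalRing.le_maximalIdeal hKtop) hmK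
    rw [ringKrullDim_eq_zero_of_isField
      ((Ideal.Quotient.maximal_ideal_iff_isField_quotient 𝔪).1 inferInstance)] at hK
    exact absurd hK (by simp)

variable [IsNoetherianRing R]

/-- A prime `q ≠ 𝔪` containing `K` and `x` would be minimal over `K`, hence associated to `R ⧸ K`. A
superficial element avoids such primes: if `q = (K : a)`, then `𝔪 ^ c * a` is killed by `x` modulo
`K`, so lies in `K`, and `𝔪 ^ c ≤ q`. -/
theorem SuperficialMod.exists_pow_le_sup_span {K : Ideal R} {x : R} (h : SuperficialMod 𝔪 K x)
    (hdim : ringKrullDim (R ⧸ K) ≤ 1) : ∃ N, 𝔪 ^ N ≤ K ⊔ Ideal.span {x} := by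
  refine Ideal.exists_pow_le_of_le_radical_of_fg ?_ (IsNoetherian.noetherian 𝔪)
  rw [Ideal.radical_eq_sInf]
  refine le_sInf ?_
  rintro q ⟨hq, hqp⟩
  have hKq : K ≤ q := le_sup_left.trans hq
  have hxq : x ∈ q := hq (Ideal.mem_sup_right (Ideal.mem_span_singleton_self x))
  by_contra hmq
  have hmap : (q.map (Ideal.Quotient.mk K)).comap (Ideal.Quotient.mk K) = q := by
    rw [Ideal.comap_map_of_surjective _ Ideal.Quotient.mk_surjective, ← RingHom.ker_eq_comap_bot,
      Ideal.mk_ker, sup_eq_left.2 hKq]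
  have hprime : (q.map (Ideal.Quotient.mk K)).IsPrime :=
    Ideal.map_isPrime_of_surjective Ideal.Quotient.mk_surjective (by rwa [Ideal.mk_ker])
  have hle : Ring.KrullDimLE 1 (R ⧸ K) := Ring.krullDimLE_iff.2 hdim
  have hmin : q ∈ K.minimalPrimes := by
    rcases Ring.krullDimLE_one_iff.1 hle _ hprime with h1 | h1
    · rw [Ideal.minimalPrimes_eq_comap]
      exact ⟨_, h1, hmap⟩
    · have := Ideal.comap_isMaximal_of_surjective (Ideal.Quotient.mk K)
        Ideal.Quotient.mk_surjective (K := q.map (Ideal.Quotient.mk K))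
      rw [hmap] at this
      exact absurd (IsLocalRing.eq_maximalIdeal this).ge hmq
  have hass : q ∈ associatedPrimes R (R ⧸ K) :=
    Module.associatedPrimes.minimalPrimes_annihilator_subset_associatedPrimes R (R ⧸ K)
      (by rwa [Ideal.annihilator_quotient])
  obtain ⟨-, z, hz⟩ := isAssociatedPrime_iff.1 hass
  obtain ⟨a, rfl⟩ := Ideal.Quotient.mk_surjective z
  have hmem : ∀ r, r ∈ q ↔ r * a ∈ K := by
    intro r
    rw [hz, Submodule.mem_colon_singleton, Submodule.mem_bot, Algebra.smul_def,
      Ideal.Quotient.algebraMap_eq, ← map_mul, Ideal.Quotient.eq_zero_iff_mem]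
  obtain ⟨c, hc⟩ := h.exists_mem_pow
  obtain ⟨s, hs, hsq⟩ := SetLike.not_le_iff_exists.1
    (fun hcq : 𝔪 ^ c ≤ q => hmq (hqp.le_of_pow_le hcq))
  refine hsq ((hmem s).2 (hc _ (Ideal.mem_sup_left (Ideal.mul_mem_right _ _ hs)) ?_))
  rw [mul_left_comm]
  exact K.mul_mem_left _ ((hmem x).1 hxq)

theorem ringKrullDim_quotient_initialIdeal_add (y : ℕ → R) {i : ℕ} (hym : ∀ j < i, y j ∈ 𝔪)
    (hreg : ∀ j < i, RegularMod (initialIdeal y j) (y j)) :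
    ringKrullDim (R ⧸ initialIdeal y i) + i = ringKrullDim R := by
  have := ringKrullDim_add_length_eq_ringKrullDim_of_isRegular _ (isRegular_map_range y hym hreg)
  rwa [List.length_map, List.length_range] at this

theorem localDepth_le_ringKrullDim : (localDepth R : WithBot ℕ∞) ≤ ringKrullDim R := by
  have h0 : (0 : WithBot ℕ∞) ≤ ringKrullDim R := ringKrullDim_nonneg_of_nontrivial
  obtain ⟨D, hD⟩ : ∃ D : ℕ∞, (D : WithBot ℕ∞) = ringKrullDim R :=
    WithBot.ne_bot_iff_exists.1 (fun h => by simp [h] at h0)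
  rw [← hD, WithBot.coe_le_coe]
  refine iSup₂_le fun rs hrs => ?_
  have h1 := ringKrullDim_add_length_eq_ringKrullDim_of_isRegular rs hrs.1
  have h2 : Nontrivial (R ⧸ Ideal.ofList rs) := by
    refine Ideal.Quotient.nontrivial_iff.2 fun h => hrs.1.top_ne_smul ?_
    rw [h, smul_eq_mul, Ideal.mul_top]
  have h3 : (0 : WithBot ℕ∞) ≤ ringKrullDim (R ⧸ Ideal.ofList rs) :=
    ringKrullDim_nonneg_of_nontrivial
  rw [← hD] at h1
  have h4 : ((rs.length : ℕ∞) : WithBot ℕ∞) ≤ (D : WithBot ℕ∞) := by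
    rw [← h1]
    exact le_add_of_nonneg_left h3
  exact WithBot.coe_le_coe.1 h4

/-- A local ring of dimension `d` with a superficial sequence of length `d` is Cohen–Macaulay iff
the last element of the sequence is regular, provided the others are. -/
theorem isCohenMacaulayLocal_iff {d : ℕ} (hdim : ringKrullDim R = ((d + 1 : ℕ) : WithBot ℕ∞))
    (y : ℕ → R) (hy : ∀ j < d + 1, SuperficialMod 𝔪 (initialIdeal y j) (y j))
    (hreg : ∀ j < d, RegularMod (initialIdeal y j) (y j)) :
    IsCohenMacaulayLocal R ↔ RegularMod (initialIdeal y d) (y d) := by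
  constructor
  · intro h
    rw [IsCohenMacaulayLocal, hdim] at h
    have h1 : localDepth R = ((d + 1 : ℕ) : ℕ∞) := WithBot.coe_injective h
    exact regularMod_of_le_ringDepth (k := d + 1) h1.ge y hy d d.lt_succ_self
  · intro h
    have h1 : ((d + 1 : ℕ) : ℕ∞) ≤ localDepth R :=
      le_idealDepth_of_regularMod (IsLocalRing.maximalIdeal.isMaximal R).ne_top y (d + 1)
        (fun j hj => (hy j hj).1) fun j hj => by
          obtain hj' | rfl := Nat.lt_succ_iff_lt_or_eq.1 hj
          · exact hreg j hj'
          · exact h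
    refine le_antisymm localDepth_le_ringKrullDim ?_
    rw [hdim]
    exact WithBot.coe_le_coe.2 h1

end Local

/-! ### Hilbert series and the second Hilbert coefficient -/

theorem mk_mul_one_sub_X_eq_of_sum_eq {F G : ℕ → ℤ} {B : ℤ[X]}
    (h : ∀ n, ∑ j ∈ Finset.range (n + 1), G j = F n + B.coeff n) :
    PowerSeries.mk G = (PowerSeries.mk F + (B : PowerSeries ℤ)) * (1 - PowerSeries.X) := by
  ext n
  rw [mul_sub, mul_one, map_sub, PowerSeries.coeff_mk]
  cases n with
  | zero =>
    have := h 0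
    simp only [zero_add, Finset.sum_range_one] at this
    simp [this]
  | succ n =>
    rw [PowerSeries.coeff_succ_mul_X, map_add, map_add, PowerSeries.coeff_mk, PowerSeries.coeff_mk,
      Polynomial.coeff_coe, Polynomial.coeff_coe, ← h, ← h, Finset.sum_range_succ]
    ring

theorem coe_one_sub_X : ((1 - X : ℤ[X]) : PowerSeries ℤ) = 1 - PowerSeries.X := by
  rw [Polynomial.coe_sub, Polynomial.coe_one, Polynomial.coe_X]

/-- Summation of coefficients is division by `1 - X`, so undoing a hyperplane section subtracts `(1
- X) ^ (k + 1) * B` from the numerator. -/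
theorem coe_sub_mul_eq_of_sum_eq {F G : ℕ → ℤ} {B h : ℤ[X]} {k : ℕ}
    (hsum : ∀ n, ∑ j ∈ Finset.range (n + 1), G j = F n + B.coeff n)
    (hh : (h : PowerSeries ℤ) = PowerSeries.mk G * (1 - PowerSeries.X) ^ k) :
    ((h - (1 - X) ^ (k + 1) * B : ℤ[X]) : PowerSeries ℤ) =
      PowerSeries.mk F * (1 - PowerSeries.X) ^ (k + 1) := by
  rw [Polynomial.coe_sub, Polynomial.coe_mul, Polynomial.coe_pow, coe_one_sub_X, hh,
    mk_mul_one_sub_X_eq_of_sum_eq hsum]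
  ring

/-- Taylor expansion at `1` turns `1 - X` into `-X`, so corrections divisible by its cube are
invisible to `e_2`. -/
theorem hasseDeriv_two_eval_one_pow_three_mul (k : ℕ) (B : ℤ[X]) :
    (hasseDeriv 2 ((1 - X) ^ (k + 3) * B)).eval 1 = 0 := by
  rw [← taylor_coeff, taylor_mul, taylor_pow]
  have : taylor 1 (1 - X : ℤ[X]) = -X := by simp
  rw [this, neg_pow, mul_assoc, ← C_1, ← C_neg, ← C_pow, coeff_C_mul, coeff_X_pow_mul']
  simp

theorem hasseDeriv_two_eval_one_sq_mul (B : ℤ[X]) :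
    (hasseDeriv 2 ((1 - X) ^ 2 * B)).eval 1 = B.eval 1 := by
  rw [← taylor_coeff, taylor_mul, taylor_pow]
  have : taylor 1 (1 - X : ℤ[X]) = -X := by simp
  rw [this, neg_sq, coeff_X_pow_mul', if_pos le_rfl, Nat.sub_self, taylor_coeff_zero]

theorem hasseDeriv_two_eval_one_C_sub (e : ℤ) (g : ℤ[X]) :
    (hasseDeriv 2 (C e - (1 - X) * g)).eval 1 = (derivative g).eval 1 := by
  rw [← taylor_coeff, map_sub, taylor_mul]
  have : taylor 1 (1 - X : ℤ[X]) = -X := by simp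
  rw [this, taylor_C, neg_mul, sub_neg_eq_add, coeff_add, coeff_X_mul, taylor_coeff_one, coeff_C]
  simp

/-- The polynomial with coefficients `f 0, …, f (N - 1)`. -/
def truncPoly (f : ℕ → ℤ) (N : ℕ) : ℤ[X] := ∑ n ∈ Finset.range N, monomial n (f n)

theorem coeff_truncPoly {f : ℕ → ℤ} {N : ℕ} (h : ∀ n, N ≤ n → f n = 0) (n : ℕ) :
    (truncPoly f N).coeff n = f n := by
  rw [truncPoly, finsetSum_coeff]
  simp only [coeff_monomial, Finset.sum_ite_eq', Finset.mem_range]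
  split_ifs with hn
  · rfl
  · exact (h n (by omega)).symm

theorem eval_one_truncPoly (f : ℕ → ℤ) (N : ℕ) :
    (truncPoly f N).eval 1 = ∑ n ∈ Finset.range N, f n := by
  simp [truncPoly, eval_finsetSum]

theorem eval_one_derivative_truncPoly (f : ℕ → ℤ) (N : ℕ) :
    (derivative (truncPoly f N)).eval 1 = ∑ n ∈ Finset.range N, n * f n := by
  simp [truncPoly, eval_finsetSum, derivative_monomial, mul_comm]

theorem coe_C_sub_mul_eq {F g : ℕ → ℤ} {e : ℤ} {N : ℕ} (hg : ∀ n, N ≤ n → g n = 0)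
    (h : ∀ n, F n = e - g n) :
    ((C e - (1 - X) * truncPoly g N : ℤ[X]) : PowerSeries ℤ) =
      PowerSeries.mk F * (1 - PowerSeries.X) ^ 1 := by
  have h1 : PowerSeries.mk F = PowerSeries.C e * PowerSeries.mk 1 -
      (truncPoly g N : PowerSeries ℤ) := by
    ext n
    rw [map_sub, PowerSeries.coeff_C_mul, PowerSeries.coeff_mk, PowerSeries.coeff_mk,
      Polynomial.coeff_coe, coeff_truncPoly hg, h, Pi.one_apply, mul_one]
  have h2 : PowerSeries.mk 1 * (1 - PowerSeries.X) = (1 : PowerSeries ℤ) :=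
    PowerSeries.mk_one_mul_one_sub_eq_one ℤ
  rw [Polynomial.coe_sub, Polynomial.coe_mul, coe_one_sub_X, Polynomial.coe_C, h1, pow_one]
  linear_combination -(PowerSeries.C e) * h2

theorem hPolynomial_eq {R : Type u} [CommRing R] {M : Type v} [AddCommGroup M] [Module R M]
    {F : ℕ → Submodule R M} {d : ℕ} {h : ℤ[X]} (hh : IsHPolynomial F d h) :
    hPolynomial F d = h := by
  have H : ∃ h : ℤ[X], IsHPolynomial F d h := ⟨h, hh⟩
  rw [hPolynomial, dif_pos H]
  refine Polynomial.coe_injective ℤ ?_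
  exact Eq.trans H.choose_spec hh.symm

section Local

variable {R : Type u} [CommRing R] [IsLocalRing R]

local notation "𝔪" => IsLocalRing.maximalIdeal R

theorem hilbertSeries_adicFiltration :
    hilbertSeries (adicFiltration 𝔪) =
      PowerSeries.mk fun n => (hilbertFun (⊥ : Ideal R) n : ℤ) := by
  ext n
  simp [hilbertSeries, hilbertFun, natLength, adicFiltration]

variable [IsNoetherianRing R]

/-- The `h`-polynomial and `e_2` for a superficial sequence `y_0, …, y_d` with `y_0, …, y_{d-1}`
regular and `d ≥ 1`, in terms of the two last hyperplane sections. -/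
theorem exists_isHPolynomial {d : ℕ} (y : ℕ → R)
    (hy : ∀ j < d + 2, SuperficialMod 𝔪 (initialIdeal y j) (y j))
    (hreg : ∀ j < d + 1, RegularMod (initialIdeal y j) (y j)) {e : ℤ} {g : ℕ → ℤ} {N : ℕ}
    (hg : ∀ n, N ≤ n → g n = 0)
    (hH : ∀ n, (hilbertFun (initialIdeal y (d + 1)) n : ℤ) = e - g n) :
    ∃ (h : ℤ[X]) (N' : ℕ), IsHPolynomial (adicFiltration 𝔪) (d + 2) h ∧
      (hasseDeriv 2 h).eval 1 = ∑ n ∈ Finset.range N, n * g n -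
        ∑ n ∈ Finset.range N',
          (natLength (colonElement (𝔪 ^ (n + 1) ⊔ initialIdeal y d) (y d))
            (𝔪 ^ n ⊔ initialIdeal y d) : ℤ) := by
  have hB : ∀ i < d + 1, ∃ N', ∀ n, N' ≤ n → natLength
      (colonElement (𝔪 ^ (n + 1) ⊔ initialIdeal y i) (y i)) (𝔪 ^ n ⊔ initialIdeal y i) = 0 :=
    fun i hi => (hy i (by omega)).natLength_colonElement_eq_zero (hreg i hi)
  have hstep : ∀ i < d + 1, ∀ N', (∀ n, N' ≤ n → natLength
      (colonElement (𝔪 ^ (n + 1) ⊔ initialIdeal y i) (y i)) (𝔪 ^ n ⊔ initialIdeal y i) = 0) →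
      ∀ n, ∑ j ∈ Finset.range (n + 1), (hilbertFun (initialIdeal y (i + 1)) j : ℤ) =
        (hilbertFun (initialIdeal y i) n : ℤ) + (truncPoly (fun n => (natLength
      (colonElement (𝔪 ^ (n + 1) ⊔ initialIdeal y i) (y i)) (𝔪 ^ n ⊔ initialIdeal y i) : ℤ))
        N').coeff n := by
    intro i hi N' hN' n
    rw [coeff_truncPoly (fun n hn => by rw [hN' n hn]; rfl), initialIdeal_succ]
    exact_mod_cast sum_hilbertFun_sup_span (initialIdeal y i) (hy i (by omega)).1 n
  obtain ⟨N', hN'⟩ := hB d d.lt_succ_self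
  have h1 := coe_sub_mul_eq_of_sum_eq (hstep d d.lt_succ_self N' hN') (coe_C_sub_mul_eq hg hH)
  have h2 : ∀ i ≤ d, ∃ h : ℤ[X],
      (h : PowerSeries ℤ) = PowerSeries.mk (fun n => (hilbertFun (initialIdeal y i) n : ℤ)) *
        (1 - PowerSeries.X) ^ (d - i + 2) ∧
      (hasseDeriv 2 h).eval 1 = ∑ n ∈ Finset.range N, n * g n - ∑ n ∈ Finset.range N',
          (natLength (colonElement (𝔪 ^ (n + 1) ⊔ initialIdeal y d) (y d))
            (𝔪 ^ n ⊔ initialIdeal y d) : ℤ) := by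
    intro i hi
    -- At `i = d` the correction has exponent two and contributes `-∑ B_n`; below that the exponent
    -- is at least three.
    induction hi using Nat.decreasingInduction with
    | self =>
      refine ⟨_, by rw [Nat.sub_self]; exact h1, ?_⟩
      rw [map_sub, eval_sub, hasseDeriv_two_eval_one_C_sub, hasseDeriv_two_eval_one_sq_mul,
        eval_one_derivative_truncPoly, eval_one_truncPoly]
    | of_succ i hi ih =>
      obtain ⟨h, hh, hh2⟩ := ih
      obtain ⟨N₁, hN₁⟩ := hB i (by omega)
      have h3 := coe_sub_mul_eq_of_sum_eq (hstep i (by omega) N₁ hN₁) hh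
      refine ⟨_, by rw [show d - i + 2 = d - (i + 1) + 2 + 1 by omega]; exact h3, ?_⟩
      rw [map_sub, eval_sub, hasseDeriv_two_eval_one_pow_three_mul, hh2, sub_zero]
  obtain ⟨h, hh, hh2⟩ := h2 0 d.zero_le
  refine ⟨h, N', ?_, hh2⟩
  rw [IsHPolynomial, hilbertSeries_adicFiltration, hh, initialIdeal_zero, Nat.sub_zero]

end Local

theorem IsSuperficialElement.superficialMod {R : Type u} [CommRing R] {m K : Ideal R} {x : R}
    (h : IsSuperficialElement m (quotFiltration (adicFiltration m) (K • (⊤ : Submodule R R))) x) :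
    SuperficialMod m K x := by
  obtain ⟨hx, c, hc⟩ := h
  have hmem : ∀ n b, (K • (⊤ : Submodule R R)).mkQ b ∈
      quotFiltration (adicFiltration m) (K • (⊤ : Submodule R R)) n ↔ b ∈ m ^ n ⊔ K := by
    intro n b
    rw [quotFiltration, ← Submodule.mem_comap, Submodule.comap_map_mkQ, smul_eq_mul,
      Ideal.mul_top, sup_comm]
    rfl
  refine ⟨hx, c, fun n hn b hb hxb => (hmem n b).1 ?_⟩
  rw [← hc n hn]
  exact ⟨(hmem (n + 1) (x * b)).2 hxb, (hmem c b).2 hb⟩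

theorem finsum_one_le_eq_sum {f : ℕ → ℤ} {N : ℕ} (hf : ∀ n, N ≤ n → f n = 0) :
    ∑ᶠ (n : ℕ) (_ : 1 ≤ n), (n : ℤ) * f n = ∑ n ∈ Finset.range N, (n : ℤ) * f n := by
  have h1 : ∀ n : ℕ, (∑ᶠ (_ : 1 ≤ n), (n : ℤ) * f n) = (n : ℤ) * f n := by
    intro n
    rw [finsum_eq_if]
    split_ifs with hn
    · rfl
    · obtain rfl : n = 0 := by omega
      simp
  rw [finsum_congr h1]
  refine finsum_eq_sum_of_support_subset _ fun n hn => ?_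
  rw [Finset.coe_range, Set.mem_Iio]
  by_contra h
  exact hn (by simp [hf n (by omega)])

/-! ### The inequality and its equality case. -/

section Local

variable {R : Type u} [CommRing R] [IsLocalRing R]

local notation "𝔪" => IsLocalRing.maximalIdeal R

/-- Passing to the quotient by `K` decreases `λ(𝔪 ^ (n + 1) / J 𝔪 ^ n)`. -/
theorem natLength_pow_succ_eq_add {K : Ideal R} {x : R} (hK : K ≤ 𝔪) (hx : x ∈ 𝔪) (n : ℕ)
    (hfin : quotLength (𝔪 ^ (n + 1)) ((K ⊔ Ideal.span {x}) * 𝔪 ^ n) ≠ ⊤) :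
    natLength (𝔪 ^ (n + 1)) ((K ⊔ Ideal.span {x}) * 𝔪 ^ n) =
      natLength (𝔪 ^ (n + 1) ⊓ ((K ⊔ Ideal.span {x}) * 𝔪 ^ n ⊔ K))
        ((K ⊔ Ideal.span {x}) * 𝔪 ^ n) +
      natLength (𝔪 ^ (n + 1) ⊔ K) (Ideal.span {x} * 𝔪 ^ n ⊔ K) := by
  have hle : (K ⊔ Ideal.span {x}) * 𝔪 ^ n ≤ 𝔪 ^ (n + 1) := by
    rw [pow_succ']
    exact Ideal.mul_mono_left (sup_le hK ((Ideal.span_singleton_le_iff_mem _).2 hx))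
  have h1 : Ideal.span {x} * 𝔪 ^ n ⊔ K = (K ⊔ Ideal.span {x}) * 𝔪 ^ n ⊔ K := by
    rw [Ideal.sup_mul, sup_comm (K * _), sup_assoc,
      sup_eq_right.2 (Ideal.mul_le_left : K * 𝔪 ^ n ≤ K)]
  have h2 : 𝔪 ^ (n + 1) ⊔ K = 𝔪 ^ (n + 1) ⊔ ((K ⊔ Ideal.span {x}) * 𝔪 ^ n ⊔ K) := by
    rw [← sup_assoc, sup_eq_left.2 hle]
  rw [h1, h2, natLength_sup_right]
  exact natLength_eq_add (le_inf hle le_sup_left) inf_le_left hfin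

variable [IsNoetherianRing R]

/-- The main inequality, with its equality case, for sequences indexed by natural numbers. -/
theorem hilbertCoeff_two_le_sum {d : ℕ} (hdim : ringKrullDim R = ((d + 2 : ℕ) : WithBot ℕ∞))
    (hdepth : ((d + 1 : ℕ) : ℕ∞) ≤ localDepth R) (y : ℕ → R)
    (hy : ∀ j < d + 2, SuperficialMod 𝔪 (initialIdeal y j) (y j)) :
    (∃ h : ℤ[X], IsHPolynomial (adicFiltration 𝔪) (d + 2) h) ∧
    (∀ n, quotLength (𝔪 ^ (n + 1)) (initialIdeal y (d + 2) * 𝔪 ^ n) ≠ ⊤) ∧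
    ∃ N : ℕ, (∀ n, N ≤ n → quotLength (𝔪 ^ (n + 1)) (initialIdeal y (d + 2) * 𝔪 ^ n) = 0) ∧
      hilbertCoeff (adicFiltration 𝔪) (d + 2) 2 ≤ ∑ n ∈ Finset.range N,
        (n : ℤ) * natLength (𝔪 ^ (n + 1)) (initialIdeal y (d + 2) * 𝔪 ^ n) ∧
      (hilbertCoeff (adicFiltration 𝔪) (d + 2) 2 = ∑ n ∈ Finset.range N,
        (n : ℤ) * natLength (𝔪 ^ (n + 1)) (initialIdeal y (d + 2) * 𝔪 ^ n) ↔
        IsCohenMacaulayLocal R ∧ ((d + 1 : ℕ) : ℕ∞) ≤ grDepth R) := by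
  have hym : ∀ j < d + 2, y j ∈ 𝔪 := fun j hj => (hy j hj).1
  have hm := (IsLocalRing.maximalIdeal.isMaximal R).ne_top
  have hreg : ∀ j < d + 1, RegularMod (initialIdeal y j) (y j) :=
    regularMod_of_le_ringDepth hdepth y fun j hj => hy j (by omega)
  have hs := hy (d + 1) (by omega)
  have hdimK : ringKrullDim (R ⧸ initialIdeal y (d + 1)) = 1 := by
    have h1 := ringKrullDim_quotient_initialIdeal_add y (fun j hj => hym j (by omega)) hreg
    rw [hdim] at h1
    generalize ringKrullDim (R ⧸ initialIdeal y (d + 1)) = D at h1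
    induction D with
    | bot =>
      rw [WithBot.bot_add] at h1
      exact absurd h1 (WithBot.bot_ne_coe (a := ((d + 2 : ℕ) : ℕ∞)))
    | coe D =>
      induction D with
      | top =>
        have h2 : (⊤ : ℕ∞) + ((d + 1 : ℕ) : ℕ∞) = ((d + 2 : ℕ) : ℕ∞) := WithBot.coe_injective h1
        rw [top_add] at h2
        exact absurd h2 (ENat.top_ne_natCast _)
      | coe D =>
        have h2 : (D : ℕ∞) + ((d + 1 : ℕ) : ℕ∞) = ((d + 2 : ℕ) : ℕ∞) := WithBot.coe_injective h1
        have h3 : D + (d + 1) = d + 2 := by exact_mod_cast h2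
        obtain rfl : D = 1 := by omega
        rfl
  obtain ⟨N₀, hN₀⟩ := hs.exists_pow_le_sup_span hdimK.le
  have hJ : initialIdeal y (d + 2) = initialIdeal y (d + 1) ⊔ Ideal.span {y (d + 1)} :=
    initialIdeal_succ y (d + 1)
  have hKm : initialIdeal y (d + 1) ≤ 𝔪 := initialIdeal_le fun j hj => hym j (by omega)
  have hJm : ∀ n, initialIdeal y (d + 2) * 𝔪 ^ n ≤ 𝔪 ^ (n + 1) := fun n => by
    rw [pow_succ']
    exact Ideal.mul_mono_left (initialIdeal_le hym)
  have hfin : ∀ n, quotLength (𝔪 ^ (n + 1)) (initialIdeal y (d + 2) * 𝔪 ^ n) ≠ ⊤ := by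
    intro n
    refine quotLength_ne_top (N := N₀ + n) (hJm n) ?_
    rw [pow_add, hJ]
    exact Ideal.mul_mono_left hN₀
  -- The empty initial segment: `J` is a reduction of `𝔪`, so `v` vanishes from `N₁` on.
  obtain ⟨N₁, hN₁⟩ := exists_pow_succ_le_mul_pow_sup y hy ⟨N₀, hJ ▸ hN₀⟩ (Nat.zero_le _)
  obtain ⟨c, hc⟩ := hs.exists_mem_pow
  obtain ⟨e, he⟩ := hs.exists_hilbertFun_eq hN₀
  have hvadd := fun n => natLength_pow_succ_eq_add hKm hs.1 n (hJ ▸ hfin n)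
  simp only [← hJ] at hvadd
  have hWfin := hs.quotLength_colonElement_inf_ne_top
  have hDfin : ∀ n, quotLength (𝔪 ^ (n + 1) ⊓ (initialIdeal y (d + 2) * 𝔪 ^ n ⊔
      initialIdeal y (d + 1))) (initialIdeal y (d + 2) * 𝔪 ^ n) ≠ ⊤ := fun n =>
    quotLength_ne_top_of_le le_rfl inf_le_left (le_inf (hJm n) le_sup_left) (hfin n)
  set v : ℕ → ℕ := fun n => natLength (𝔪 ^ (n + 1)) (initialIdeal y (d + 2) * 𝔪 ^ n) with hv
  set v' : ℕ → ℕ := fun n => natLength (𝔪 ^ (n + 1) ⊔ initialIdeal y (d + 1))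
    (Ideal.span {y (d + 1)} * 𝔪 ^ n ⊔ initialIdeal y (d + 1))
  set W : ℕ → ℕ := fun n => natLength (colonElement (initialIdeal y (d + 1)) (y (d + 1)) ⊓
    (𝔪 ^ n ⊔ initialIdeal y (d + 1))) (initialIdeal y (d + 1))
  set D : ℕ → ℕ := fun n => natLength (𝔪 ^ (n + 1) ⊓ (initialIdeal y (d + 2) * 𝔪 ^ n ⊔
      initialIdeal y (d + 1))) (initialIdeal y (d + 2) * 𝔪 ^ n)
  have hvadd' : ∀ n, v n = D n + v' n := hvadd
  have hvz : ∀ n, max N₁ c ≤ n → quotLength (𝔪 ^ (n + 1)) (initialIdeal y (d + 2) * 𝔪 ^ n) = 0 :=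
    fun n hn => quotLength_eq_zero_iff.2 (by simpa using hN₁ n (by omega))
  have hvz' : ∀ n, max N₁ c ≤ n → v n = 0 := fun n hn => by
    simp only [hv, natLength, hvz n hn, ENat.toNat_zero]
  have hWz : ∀ n, max N₁ c ≤ n → W n = 0 := fun n hn =>
    natLength_eq_zero fun a ha => hc a (by
      have hle : 𝔪 ^ n ⊔ initialIdeal y (d + 1) ≤ 𝔪 ^ c ⊔ initialIdeal y (d + 1) :=
        sup_le_sup_right (Ideal.pow_le_pow_right (by omega)) _
      exact hle ha.2) ha.1
  obtain ⟨h, N', hh, h2⟩ := exists_isHPolynomial (d := d) y hy hreg (e := e)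
    (g := fun n => (v' n : ℤ) - W n) (N := max N₁ c)
    (fun n hn => by
      have h1 := hvz' n hn
      have h3 := hvadd' n
      have h4 := hWz n hn
      omega) he
  have hcoeff : hilbertCoeff (adicFiltration 𝔪) (d + 2) 2 = (hasseDeriv 2 h).eval 1 := by
    rw [hilbertCoeff, hPolynomial_eq hh]
  set B : ℕ → ℕ := fun n => natLength (colonElement (𝔪 ^ (n + 1) ⊔ initialIdeal y d) (y d))
            (𝔪 ^ n ⊔ initialIdeal y d)
  -- The defect of the inequality as a natural number, which settles both the sign and the equality
  -- case.
  have hdiff : ∑ n ∈ Finset.range (max N₁ c), (n : ℤ) * (v n : ℤ) =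
      hilbertCoeff (adicFiltration 𝔪) (d + 2) 2 +
        ((∑ n ∈ Finset.range (max N₁ c), n * (D n + W n) +
          ∑ n ∈ Finset.range N', B n : ℕ) : ℤ) := by
    have h3 : ∑ n ∈ Finset.range (max N₁ c), (n : ℤ) * (v n : ℤ) =
        ∑ n ∈ Finset.range (max N₁ c), (n : ℤ) * ((v' n : ℤ) - W n) +
          ∑ n ∈ Finset.range (max N₁ c), (n : ℤ) * ((D n : ℤ) + W n) := by
      rw [← Finset.sum_add_distrib]
      refine Finset.sum_congr rfl fun n _ => ?_
      rw [hvadd' n]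
      push_cast
      ring
    rw [hcoeff, h2, h3]
    push_cast
    ring
  refine ⟨⟨h, hh⟩, hfin, max N₁ c, hvz, ?_, ?_⟩
  · change _ ≤ ∑ n ∈ Finset.range (max N₁ c), (n : ℤ) * (v n : ℤ)
    rw [hdiff]
    exact le_add_of_nonneg_right (Int.natCast_nonneg _)
  change _ = ∑ n ∈ Finset.range (max N₁ c), (n : ℤ) * (v n : ℤ) ↔ _
  rw [hdiff, left_eq_add, Int.natCast_eq_zero, Nat.add_eq_zero_iff, Finset.sum_eq_zero_iff,
    Finset.sum_eq_zero_iff, isCohenMacaulayLocal_iff hdim y hy hreg, grDepth_eq_ringDepth]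
  constructor
  -- Vanishing of `D n` and `W n` for `n ≥ 1` already gives both conclusions.
  · rintro ⟨h3, -⟩
    have h4 : ∀ n, 1 ≤ n → D n = 0 ∧ W n = 0 := by
      intro n hn
      by_cases hnN : n < max N₁ c
      · have := (Nat.mul_eq_zero.1 (h3 n (Finset.mem_range.2 hnN))).resolve_left (by omega)
        omega
      · have h5 := hvz' n (by omega)
        have h6 := hvadd' n
        exact ⟨by omega, hWz n (by omega)⟩
    have hxreg : RegularMod (initialIdeal y (d + 1)) (y (d + 1)) :=
      (colonElement_inf_le_iff_regularMod hdimK).1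
        (le_of_natLength_eq_zero (hWfin 1) (h4 1 le_rfl).2)
    refine ⟨hxreg, le_ringDepth_grIrrelevant_of_inf_pow_le hm (d + 1) y
      (fun j hj => hym j (by omega)) (fun j hj => ?_) fun n => ?_⟩
    · obtain hj' | rfl := hj.lt_or_eq
      · exact hreg j hj'
      · exact hxreg
    -- The term `n = 0` has weight zero and carries no information, but there the inclusion is just
    -- `K ≤ J`.
    · obtain rfl | hn := n.eq_zero_or_pos
      · rw [pow_zero, mul_one]
        exact inf_le_left.trans (initialIdeal_mono y (Nat.le_succ _))
      · exact (le_inf inf_le_right (inf_le_left.trans le_sup_right)).trans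
          (le_of_natLength_eq_zero (hDfin n) (h4 n hn).1)
  · rintro ⟨hxreg, hgr⟩
    obtain ⟨h3, h4⟩ := inf_pow_le_of_le_ringDepth_grIrrelevant hm hgr y
      (fun j hj => hy j (by omega))
    refine ⟨fun n _ => ?_, fun n _ => natLength_eq_zero (h4 d d.lt_succ_self n)⟩
    have hW0 : W n = 0 := natLength_eq_zero fun a ha => hxreg a ha.1
    have hD0 : D n = 0 := by
      refine natLength_eq_zero ?_
      rintro z ⟨hzm, hz⟩
      obtain ⟨p, hp, q, hq, rfl⟩ := Submodule.mem_sup.1 hz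
      refine Ideal.add_mem _ hp (Ideal.mul_mono_left (initialIdeal_mono y (Nat.le_succ _))
        (h3 (d + 1) le_rfl n ⟨hq, ?_⟩))
      have := Ideal.sub_mem _ hzm (hJm n hp)
      rwa [add_sub_cancel_left] at this
    rw [hW0, hD0, add_zero, mul_zero]

end Local

end

theorem mainTheorem7 {R : Type u} [CommRing R] [IsLocalRing R] [IsNoetherianRing R]
    (d : ℕ) (hd : 2 ≤ d) (hdim : ringKrullDim R = (d : WithBot ℕ∞))
    (hdepth : ((d - 1 : ℕ) : ℕ∞) ≤ localDepth R)
    (x : Fin d → R)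
    (hx : IsSuperficialSequence (IsLocalRing.maximalIdeal R)
      (adicFiltration (IsLocalRing.maximalIdeal R)) x)
    (J : Ideal R) (hJ : J = Ideal.span (Set.range x)) :
    -- the Hilbert coefficients are defined, and the sum below is a finite sum of finite lengths
    (∃ h : ℤ[X], IsHPolynomial (adicFiltration (IsLocalRing.maximalIdeal R)) d h) ∧
    (∀ n : ℕ, quotLength (IsLocalRing.maximalIdeal R ^ (n + 1))
      (J * IsLocalRing.maximalIdeal R ^ n) ≠ ⊤) ∧
    {n : ℕ | quotLength (IsLocalRing.maximalIdeal R ^ (n + 1))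
      (J * IsLocalRing.maximalIdeal R ^ n) ≠ 0}.Finite ∧
    hilbertCoeff (adicFiltration (IsLocalRing.maximalIdeal R)) d 2 ≤
      ∑ᶠ (n : ℕ) (_ : 1 ≤ n), (n : ℤ) *
        ((quotLength (IsLocalRing.maximalIdeal R ^ (n + 1))
          (J * IsLocalRing.maximalIdeal R ^ n)).toNat : ℤ) ∧
    (hilbertCoeff (adicFiltration (IsLocalRing.maximalIdeal R)) d 2 =
      ∑ᶠ (n : ℕ) (_ : 1 ≤ n), (n : ℤ) *
        ((quotLength (IsLocalRing.maximalIdeal R ^ (n + 1))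
          (J * IsLocalRing.maximalIdeal R ^ n)).toNat : ℤ) ↔
      IsCohenMacaulayLocal R ∧ ((d - 1 : ℕ) : ℕ∞) ≤ grDepth R) := by
  obtain ⟨d, rfl⟩ : ∃ l, d = l + 2 := ⟨d - 2, by omega⟩
  -- Extension by zero; only the indices below `d + 2` matter.
  let y : ℕ → R := fun j => if h : j < d + 2 then x ⟨j, h⟩ else 0
  have hyx : ∀ j : Fin (d + 2), y j = x j := fun j => dif_pos j.2
  have hspan : ∀ i ≤ d + 2, initialIdeal y i = Ideal.span (x '' {j | j.1 < i}) := by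
    intro i hi
    rw [initialIdeal_eq_span]
    congr 1
    ext a
    constructor
    · rintro ⟨j, hj, rfl⟩
      exact ⟨⟨j, lt_of_lt_of_le hj hi⟩, hj, (hyx ⟨j, lt_of_lt_of_le hj hi⟩).symm⟩
    · rintro ⟨j, hj, rfl⟩
      exact ⟨j, hj, hyx j⟩
  have hJy : J = initialIdeal y (d + 2) := by
    rw [hJ, hspan _ le_rfl, ← Set.image_univ]
    congr 2
    ext j
    simp
  have hy : ∀ j < d + 2, SuperficialMod (IsLocalRing.maximalIdeal R) (initialIdeal y j) (y j) := by
    intro j hj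
    have h1 := (hx ⟨j, hj⟩).superficialMod
    rw [hspan j hj.le, hyx ⟨j, hj⟩]
    exact h1
  obtain ⟨h1, h2, N, h3, h4, h5⟩ := hilbertCoeff_two_le_sum hdim hdepth y hy
  rw [← hJy] at h2 h3 h4 h5
  refine ⟨h1, h2, (Set.finite_lt_nat N).subset fun n hn => ?_, ?_⟩
  · by_contra h
    exact hn (h3 n (not_lt.1 h))
  · rw [finsum_one_le_eq_sum (N := N) fun n hn => by rw [h3 n hn]; rfl]
    exact ⟨h4, h5⟩
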